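/- For a complex vector space $V$ let $QO(V)$ be the space of linear maps $a:V\to V((z))$, written $a(z)=\sum_{m\in\mathbb{Z}}a(m)z^{-m-1}$, with the circle products $$a(w)\circ_k b(w)=\mathrm{Res}_z\, a(z)b(w)\,\iota_{|z|>|w|}(z-w)^k-\mathrm{Res}_z\, b(w)a(z)\,\iota_{|w|>|z|}(z-w)^k,\qquad k\in\mathbb{Z},$$ and the Wick product $:ab:\;=a\circ_{-1}b$. Let $\mathcal{H}(n)\subset QO(V)$ be the rank $n$ Heisenberg vertex algebra, i.e. the smallest linear subspace that contains $1$ and the Heisenberg fields $\alpha^1,\dots,\alpha^n$, with $\alpha^i(z)\alpha^j(w)\sim\delta_{i,j}(z-w)^{-2}$, and is closed under all circle products; here $V$ is the Fock space of rank $n$. Let $O(n)$ be the complex orthogonal group, acting on $\mathcal{H}(n)$ by the automorphisms that extend its standard linear action on the span of $\alpha^1,\dots,\alpha^n$, and let $\mathcal{H}(n)^{O(n)}$ be the subalgebra of invariants. Put $$j^0=\sum_{i=1}^n :\alpha^i\alpha^i:,\qquad j^2=\sum_{i=1}^n :\alpha^i\,\partial^2\alpha^i:,$$ so that $j^0$ is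 twice the Virasoro element and $j^2$ has weight $4$. **Lemma.** For every $n\ge 1$, $\mathcal{H}(n)^{O(n)}$ is generated as a vertex algebra by $j^0$ and $j^2$: both fields lie in $\mathcal{H}(n)^{O(n)}$, and every element of $\mathcal{H}(n)^{O(n)}$ is a linear combination of nonassociative words in the letters $j^0$, $j^2$ and the operations $\circ_k$, $k\in\mathbb{Z}$. -/

import Mathlib

noncomputable section

namespace QOA

open VertexOperator

variable {V : Type*} [AddCommGroup V] [Module ℂ V]

/-! ### Fields

`VertexOperator ℂ V` is the space `QO(V)` of all linear maps `V → V((z))`, written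
`a(z) = ∑ a(m) z ^ (-m-1)`; the Fourier mode `a(m)` is `ncoeff a m`. -/

/-- The field `∑ f m z ^ (-m-1)` with prescribed Fourier modes. -/
def ofModes (f : ℤ → Module.End ℂ V) (hf : ∀ v, ∃ N : ℤ, ∀ m ≥ N, f m v = 0) :
    VertexOperator ℂ V :=
  VertexOperator.of_coeff (fun e => f (-e - 1)) (by
    intro v
    obtain ⟨N, hN⟩ := hf v
    refine ⟨-N, fun e he => ?_⟩
    by_contra hlt
    exact he (hN _ (by omega)))

theorem ncoeff_ofModes (f : ℤ → Module.End ℂ V) (hf : ∀ v, ∃ N : ℤ, ∀ m ≥ N, f m v = 0) (m : ℤ) :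
    ncoeff (ofModes f hf) m = f m := by
  rw [ofModes, VertexOperator.ncoeff_of_coeff]
  congr 1
  omega

theorem ext_modes {a b : VertexOperator ℂ V} (h : ∀ m, ncoeff a m = ncoeff b m) : a = b := by
  apply HVertexOperator.coeff_inj
  funext e
  rw [VertexOperator.coeff_eq_ncoeff, VertexOperator.coeff_eq_ncoeff, h]

theorem exists_ncoeff_eq_zero (a : VertexOperator ℂ V) (v : V) :
    ∃ N : ℤ, ∀ m ≥ N, ncoeff a m v = 0 :=
  ⟨-((HahnModule.of ℂ).symm (a v)).order, fun m hm =>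
    VertexOperator.ncoeff_eq_zero_of_lt_order a m v (by omega)⟩

/-- The identity field `1`. -/
def one : VertexOperator ℂ V :=
  ofModes (fun m => if m = -1 then 1 else 0) (fun v => ⟨0, fun m hm => by
    rw [if_neg (by omega), LinearMap.zero_apply]⟩)

/-- The formal derivative `∂ a = (d/dz) a(z)`, whose modes are `(∂ a)(m) = -m a(m-1)`. -/
def derivative (a : VertexOperator ℂ V) : VertexOperator ℂ V :=
  ofModes (fun m => (-(m : ℂ)) • ncoeff a (m - 1)) (fun v => by
    obtain ⟨N, hN⟩ := exists_ncoeff_eq_zero a v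
    exact ⟨N + 1, fun m hm => by rw [LinearMap.smul_apply, hN _ (by omega), smul_zero]⟩)

/-! ### Circle products

`a(w) ∘ₙ b(w) = Res_z a(z) b(w) ι_{|z|>|w|} (z-w)ⁿ - Res_z b(w) a(z) ι_{|w|>|z|} (z-w)ⁿ`.
Expanding the two binomial series and taking the coefficient of `w ^ (-m-1)` gives
`∑_{j ≥ 0} (-1)ʲ (n choose j) (a(n-j) b(m+j) - (-1)ⁿ b(m+n-j) a(j))`,
a sum with only finitely many nonzero terms when applied to a vector. -/

/-- The `j`-th term of the `m`-th mode of `a ∘ₙ b`. -/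
def circTerm (n : ℤ) (a b : VertexOperator ℂ V) (m : ℤ) (j : ℕ) : Module.End ℂ V :=
  (((-1 : ℂ) ^ j) * ((Ring.choose n j : ℤ) : ℂ)) •
    (ncoeff a (n - j) * ncoeff b (m + j) -
      ((-1 : ℂ) ^ n) • (ncoeff b (m + n - j) * ncoeff a j))

theorem finite_support_circTerm (n : ℤ) (a b : VertexOperator ℂ V) (m : ℤ) (v : V) :
    (Function.support fun j : ℕ => circTerm n a b m j v).Finite := by
  obtain ⟨N, hN⟩ := exists_ncoeff_eq_zero a v
  obtain ⟨M, hM⟩ := exists_ncoeff_eq_zero b v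
  refine (Set.finite_lt_nat (N.toNat + (M - m).toNat)).subset fun j hj => ?_
  by_contra hlt
  simp only [Set.mem_ofPred_eq, not_lt] at hlt
  refine hj ?_
  simp only [circTerm, LinearMap.smul_apply, LinearMap.sub_apply, Module.End.mul_apply]
  rw [hN _ (by omega), hM _ (by omega)]
  simp

/-- The `m`-th mode of `a ∘ₙ b`. -/
def circMode (n : ℤ) (a b : VertexOperator ℂ V) (m : ℤ) : Module.End ℂ V where
  toFun v := ∑ᶠ j : ℕ, circTerm n a b m j v
  map_add' v w := by
    simp only [map_add]
    exact finsum_add_distrib (finite_support_circTerm n a b m v)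
      (finite_support_circTerm n a b m w)
  map_smul' c v := by
    simp only [map_smul, RingHom.id_apply]
    exact (smul_finsum c _).symm

/-- The `n`-th circle product `a ∘ₙ b`, for `n : ℤ`. -/
def circ (n : ℤ) (a b : VertexOperator ℂ V) : VertexOperator ℂ V :=
  ofModes (circMode n a b) (fun v => by
    obtain ⟨N, hN⟩ := exists_ncoeff_eq_zero a v
    obtain ⟨M, hM⟩ := exists_ncoeff_eq_zero b v
    choose K hK using fun j : ℕ => exists_ncoeff_eq_zero b (ncoeff a j v)
    obtain ⟨B, hB⟩ := (((Finset.range N.toNat).image fun j : ℕ => K j - n + j) : Finset ℤ).bddAbove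
    refine ⟨max M B, fun m hm => finsum_eq_zero_of_forall_eq_zero fun j => ?_⟩
    have hm1 : M ≤ m := le_trans (le_max_left _ _) hm
    have hm2 : B ≤ m := le_trans (le_max_right _ _) hm
    have h2 : ncoeff b (m + n - j) (ncoeff a j v) = 0 := by
      by_cases hj : j < N.toNat
      · have : K j - n + j ≤ B := hB (by
          simp only [Finset.coe_image, Finset.coe_range, Set.mem_image, Set.mem_Iio]
          exact ⟨j, hj, rfl⟩)
        exact hK j _ (by omega)
      · rw [hN _ (by omega), map_zero]
    simp only [circTerm, LinearMap.smul_apply, LinearMap.sub_apply, Module.End.mul_apply]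
    rw [hM _ (by omega), h2]
    simp)

theorem ncoeff_circ (n : ℤ) (a b : VertexOperator ℂ V) (m : ℤ) (v : V) :
    ncoeff (circ n a b) m v = ∑ᶠ j : ℕ, circTerm n a b m j v := by
  rw [circ, ncoeff_ofModes]
  rfl

/-- The Wick product `:ab:`, which is the circle product `a ∘₋₁ b`. -/
def wick (a b : VertexOperator ℂ V) : VertexOperator ℂ V := circ (-1) a b

/-! ### Quantum operator algebras and generation -/

/-- A quantum operator algebra: a linear subspace of `QO(V)` that contains `1` and is closed under
all circle products. -/
structure Algebra (V : Type*) [AddCommGroup V] [Module ℂ V] extends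
    Submodule ℂ (VertexOperator ℂ V) where
  one_mem' : one ∈ carrier
  circ_mem' : ∀ (n : ℤ) {a b : VertexOperator ℂ V},
    a ∈ carrier → b ∈ carrier → circ n a b ∈ carrier

instance : SetLike (Algebra V) (VertexOperator ℂ V) where
  coe A := A.carrier
  coe_injective A B h := by
    obtain ⟨A, _, _⟩ := A
    obtain ⟨B, _, _⟩ := B
    congr 1
    exact SetLike.coe_injective h

/-- The smallest quantum operator algebra containing `S`. -/
def closure (S : Set (VertexOperator ℂ V)) : Algebra V where
  toSubmodule := sInf {W | ∃ A : Algebra V, S ⊆ A.carrier ∧ W = A.toSubmodule}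
  one_mem' := Submodule.mem_sInf.2 (by
    rintro _ ⟨A, -, rfl⟩
    exact A.one_mem')
  circ_mem' n a b ha hb := Submodule.mem_sInf.2 (by
    rintro _ ⟨A, hA, rfl⟩
    exact A.circ_mem' n (Submodule.mem_sInf.1 ha _ ⟨A, hA, rfl⟩)
      (Submodule.mem_sInf.1 hb _ ⟨A, hA, rfl⟩))

/-- The nonassociative words in the letters `S` and the operations `∘ₙ`, `n : ℤ`. -/
inductive IsWord (S : Set (VertexOperator ℂ V)) : VertexOperator ℂ V → Prop
  | letter {a : VertexOperator ℂ V} (ha : a ∈ S) : IsWord S a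
  | circ (n : ℤ) {a b : VertexOperator ℂ V} (ha : IsWord S a) (hb : IsWord S b) :
      IsWord S (circ n a b)

/-- `S` generates `A`: `S` is a subset of `A` and every element of `A` is a linear combination of
nonassociative words in the letters `S` and the operations `∘ₙ`, `n : ℤ`. -/
def Generates (S : Set (VertexOperator ℂ V)) (A : Algebra V) : Prop :=
  S ⊆ (A : Set (VertexOperator ℂ V)) ∧ ∀ a ∈ A, a ∈ Submodule.span ℂ {w | IsWord S w}

end QOA

namespace Heisenberg

open VertexOperator QOA MvPolynomial

/-! ### The rank `n` Heisenberg vertex algebra -/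

/-- The Fock space of rank `n`, that is the `n`-th tensor power of the module induced from the
trivial character. It is the polynomial ring in the variables `X (i, k)`, which stands for the
creation operator `αⁱ(-k-1)` applied to the vacuum vector `1`. -/
abbrev Fock (n : ℕ) : Type := MvPolynomial (Fin n × ℕ) ℂ

/-- The Heisenberg operators: `αⁱ(-k-1)` is multiplication by `X (i, k)`, `αⁱ(0) = 0`, and
`αⁱ(k+1)` is `(k+1) ∂/∂X (i, k)`. -/
def mode {n : ℕ} (i : Fin n) : ℤ → Module.End ℂ (Fock n)
  | Int.ofNat 0 => 0
  | Int.ofNat (k + 1) => ((k : ℂ) + 1) • (pderiv (i, k)).toLinearMap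
  | Int.negSucc k => LinearMap.mulLeft ℂ (X (i, k))

/-- The generating field `αⁱ(z) = ∑ αⁱ(m) z ^ (-m-1)`. -/
def alpha {n : ℕ} (i : Fin n) : VertexOperator ℂ (Fock n) :=
  ofModes (mode i) (fun p => by
    classical
    obtain ⟨N, hN⟩ := (p.vars.image Prod.snd).bddAbove
    refine ⟨N + 2, fun m hm => ?_⟩
    obtain ⟨k, rfl⟩ : ∃ k : ℕ, m = Int.ofNat (k + 1) :=
      ⟨(m - 1).toNat, by simp only [Int.ofNat_eq_natCast]; omega⟩
    have hk : (i, k) ∉ p.vars := fun h => by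
      have h1 : k ≤ N := hN (by
        simp only [Finset.coe_image, Set.mem_image, Finset.mem_coe]
        exact ⟨(i, k), h, rfl⟩)
      simp only [Int.ofNat_eq_natCast] at hm
      omega
    simp only [mode, LinearMap.smul_apply, Derivation.coeFn_coe]
    rw [pderiv_eq_zero_of_notMem_vars hk, smul_zero])

/-- The rank `n` Heisenberg vertex algebra `H(n)`, generated by `α¹, …, αⁿ`. -/
def algebra (n : ℕ) : Algebra (Fock n) := closure (Set.range alpha)

/-! ### The action of the orthogonal group -/

/-- The linear substitution `X (i, k) ↦ ∑ⱼ g j i X (j, k)` on the Fock space. -/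
def subst {n : ℕ} (g : Matrix (Fin n) (Fin n) ℂ) : Fock n →ₐ[ℂ] Fock n :=
  aeval fun x => ∑ j, C (g j x.1) * X (j, x.2)

theorem subst_transpose_subst {n : ℕ} {g : Matrix (Fin n) (Fin n) ℂ}
    (hg : g ∈ Matrix.orthogonalGroup (Fin n) ℂ) (p : Fock n) : subst g.transpose (subst g p) = p := by
  suffices h : (subst g.transpose).comp (subst g) = AlgHom.id ℂ (Fock n) from
    DFunLike.congr_fun h p
  apply MvPolynomial.algHom_ext
  rintro ⟨i, k⟩
  have h1 : ∀ l, ∑ j, g j i * g j l = if i = l then 1 else 0 := fun l => by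
    have := congrFun (congrFun (Matrix.mem_orthogonalGroup_iff' (Fin n) ℂ |>.1 hg) i) l
    simpa [Matrix.mul_apply, Matrix.one_apply] using this
  have h2 : ∑ j, C (g j i) * ∑ l, C (g j l) * X (l, k) = (X (i, k) : Fock n) := by
    calc ∑ j, C (g j i) * ∑ l, C (g j l) * X (l, k)
        = ∑ l, C (∑ j, g j i * g j l) * (X (l, k) : Fock n) := by
          simp only [Finset.mul_sum, map_sum, Finset.sum_mul, map_mul]
          rw [Finset.sum_comm]
          simp only [mul_assoc]
      _ = X (i, k) := by
          simp [h1, apply_ite]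
  simpa [subst, ← MvPolynomial.algebraMap_eq] using h2

/-- The action of `g` in `O(n)` on fields: conjugation by `subst g`, whose inverse is
`subst g.transpose`. It sends `αⁱ` to `∑ⱼ g j i αʲ`. -/
def act {n : ℕ} (g : Matrix (Fin n) (Fin n) ℂ) (a : VertexOperator ℂ (Fock n)) :
    VertexOperator ℂ (Fock n) :=
  ofModes (fun m => (subst g).toLinearMap * ncoeff a m * (subst g.transpose).toLinearMap)
    (fun v => by
      obtain ⟨N, hN⟩ := exists_ncoeff_eq_zero a (subst g.transpose v)
      exact ⟨N, fun m hm => by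
        simp only [Module.End.mul_apply, AlgHom.toLinearMap_apply, hN m hm, map_zero]⟩)

theorem subst_subst_transpose {n : ℕ} {g : Matrix (Fin n) (Fin n) ℂ}
    (hg : g ∈ Matrix.orthogonalGroup (Fin n) ℂ) (p : Fock n) : subst g (subst g.transpose p) = p := by
  have h : g.transpose ∈ Matrix.orthogonalGroup (Fin n) ℂ := by
    rw [Matrix.mem_orthogonalGroup_iff', Matrix.transpose_transpose]
    exact (Matrix.mem_orthogonalGroup_iff (Fin n) ℂ).1 hg
  simpa using subst_transpose_subst h p

theorem act_one {n : ℕ} {g : Matrix (Fin n) (Fin n) ℂ}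
    (hg : g ∈ Matrix.orthogonalGroup (Fin n) ℂ) : act g one = one := by
  apply ext_modes
  intro m
  refine LinearMap.ext fun v => ?_
  rw [act, one, ncoeff_ofModes, ncoeff_ofModes]
  simp only [Module.End.mul_apply, AlgHom.toLinearMap_apply]
  split_ifs
  · exact subst_subst_transpose hg v
  · simp

theorem act_circ {n : ℕ} {g : Matrix (Fin n) (Fin n) ℂ}
    (hg : g ∈ Matrix.orthogonalGroup (Fin n) ℂ) (r : ℤ) (a b : VertexOperator ℂ (Fock n)) :
    act g (circ r a b) = circ r (act g a) (act g b) := by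
  apply ext_modes
  intro m
  refine LinearMap.ext fun v => ?_
  rw [ncoeff_circ, act, ncoeff_ofModes]
  simp only [Module.End.mul_apply, AlgHom.toLinearMap_apply, ncoeff_circ]
  have h := (subst g).toLinearMap.toAddMonoidHom.map_finsum
    (finite_support_circTerm r a b m (subst g.transpose v))
  refine h.trans (finsum_congr fun j => ?_)
  simp [circTerm, act, ncoeff_ofModes, subst_transpose_subst hg]

/-- The invariant vertex algebra `H(n)^{O(n)}`, where `O(n)` is the complex orthogonal group. -/
def invariants (n : ℕ) : Algebra (Fock n) where
  carrier := {a | a ∈ algebra n ∧ ∀ g ∈ Matrix.orthogonalGroup (Fin n) ℂ, act g a = a}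
  zero_mem' := by
    refine ⟨(algebra n).zero_mem', fun g _ => ext_modes fun m => ?_⟩
    refine LinearMap.ext fun v => ?_
    simp [act, ncoeff_ofModes]
  add_mem' := by
    rintro a b ⟨ha, ha'⟩ ⟨hb, hb'⟩
    refine ⟨(algebra n).add_mem' ha hb, fun g hg => ext_modes fun m => ?_⟩
    have h1 := congrArg (fun c => ncoeff c m) (ha' g hg)
    have h2 := congrArg (fun c => ncoeff c m) (hb' g hg)
    simp only [act, ncoeff_ofModes] at h1 h2 ⊢
    simp only [map_add, Pi.add_apply, mul_add, add_mul, h1, h2]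
  smul_mem' := by
    rintro c a ⟨ha, ha'⟩
    refine ⟨(algebra n).smul_mem' c ha, fun g hg => ext_modes fun m => ?_⟩
    have h1 := congrArg (fun c => ncoeff c m) (ha' g hg)
    simp only [act, ncoeff_ofModes] at h1 ⊢
    simp only [map_smul, Pi.smul_apply, mul_smul_comm, smul_mul_assoc, h1]
  one_mem' := ⟨(algebra n).one_mem', fun _ hg => act_one hg⟩
  circ_mem' := by
    rintro r a b ⟨ha, ha'⟩ ⟨hb, hb'⟩
    exact ⟨(algebra n).circ_mem' r ha hb, fun g hg => by
      rw [act_circ hg, ha' g hg, hb' g hg]⟩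

/-! ### The quadratic invariants -/

/-- `ω_{a,b} = ∑ᵢ :∂ᵃαⁱ ∂ᵇαⁱ:`. -/
def omega (n a b : ℕ) : VertexOperator ℂ (Fock n) :=
  ∑ i, wick (derivative^[a] (alpha i)) (derivative^[b] (alpha i))

/-- `j^k = ω_{0,k}` (used for even `k`); in particular `j^0 = ∑ᵢ :αⁱαⁱ:`, twice the Virasoro
element, and `j^2 = ∑ᵢ :αⁱ ∂²αⁱ:`. -/
def j (n k : ℕ) : VertexOperator ℂ (Fock n) := omega n 0 k

end Heisenberg

end

/-! ### Gaussian means of harmonic polynomials -/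

namespace MvPolynomial

open MeasureTheory ProbabilityTheory

/-! The argument passes from fields to states. The Heisenberg fields are mutually local and
translation covariant, and by Dong's lemma and a binomial identity so is everything in
`Heisenberg.algebra n`. Hence a field `a` there is determined by its state `a(-1) 1` in the
polynomial ring `Fock n` (`eq_of_state_eq`), and the state of `a ∘ₘ b` is `a(m)` applied to the
state of `b`. An invariant field has an invariant state, so it suffices that every O(n)-invariant
polynomial is the state of a combination of words in `j⁰` and `j²`.

By the first fundamental theorem, invariant polynomials are spanned by products of the quadrics
`q_{c,d} = ∑ᵢ X(i,c) X(i,d)`. All quadrics are reached from `q_{0,0}`: the mode `j⁰(0)` acts as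
twice translation, which makes the suitably scaled quadrics of a given weight proportional modulo
those already reached; the mode `j²(1)` raises the weight by two with a nonzero coefficient.
Products follow by induction on the degree, since `ω_{c,d}(-1)` is multiplication by a nonzero
multiple of `q_{c,d}` up to terms of lower degree. The vacuum is not a letter; it appears as `j⁰(3)
q_{0,0} = 2n`, which is where `n ≥ 1` enters.

The fundamental theorem is proved over ℝ with the Fischer form and then complexified. Let `p` be
invariant, homogeneous of positive degree and killed by all polarized Laplacians. The matrix
coefficient `F(G) = ⟨G p, p⟩` is a harmonic homogeneous polynomial in the entries of `G`. By polar
decomposition and invariance `F ≥ 0`, while harmonicity makes its Gaussian mean zero. So `F = 0`,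
and `F(1) = ⟨p, p⟩` gives `p = 0`. As multiplication by a quadric is adjoint to a Laplacian,
orthogonal projection then writes every invariant of positive degree through quadrics times lower
invariants. -/

theorem integrable_pow_gaussianReal (k : ℕ) :
    Integrable (fun x : ℝ => x ^ k) (gaussianReal 0 1) := by
  have h := (memLp_id_gaussianReal (μ := 0) (v := 1) (k : NNReal)).integrable_norm_pow'
  refine h.mono' (by fun_prop) (Filter.Eventually.of_forall fun x => ?_)
  simp

theorem integrable_pow_mul_exp (k : ℕ) :
    Integrable (fun x : ℝ => x ^ k * Real.exp (-(x ^ 2) / 2)) := by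
  have h := integrable_rpow_mul_exp_neg_mul_sq (b := 1 / 2) (by norm_num) (s := k)
    (by have : (0 : ℝ) ≤ k := k.cast_nonneg; linarith)
  refine h.congr (Filter.Eventually.of_forall fun x => ?_)
  simp only [Real.rpow_natCast]
  congr 2
  ring

theorem integral_gaussianReal_eq (f : ℝ → ℝ) :
    ∫ x, f x ∂gaussianReal 0 1 = (√(2 * Real.pi))⁻¹ * ∫ x, f x * Real.exp (-(x ^ 2) / 2) := by
  rw [integral_gaussianReal_eq_integral_smul one_ne_zero, ← integral_const_mul]
  refine integral_congr_ae (Filter.Eventually.of_forall fun x => ?_)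
  simp [gaussianPDFReal]
  ring

/-- Integration by parts: the derivative of `exp (-x²/2)` is `-x exp (-x²/2)`. At `k = 0` the factor
`k` makes the truncated exponent `k - 1` harmless. -/
theorem integral_pow_succ_gaussianReal (k : ℕ) :
    ∫ x, x ^ (k + 1) ∂gaussianReal 0 1 = ∫ x, k * x ^ (k - 1) ∂gaussianReal 0 1 := by
  rw [integral_gaussianReal_eq, integral_gaussianReal_eq]
  congr 1
  have h := integral_mul_deriv_eq_deriv_mul_of_integrable
    (u := fun x : ℝ => x ^ k) (u' := fun x => k * x ^ (k - 1))
    (v := fun x : ℝ => Real.exp (-(x ^ 2) / 2)) (v' := fun x => -x * Real.exp (-(x ^ 2) / 2))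
    (fun x _ => hasDerivAt_pow k x)
    (fun x _ => by
      have h1 : HasDerivAt (fun x : ℝ => -(x ^ 2) / 2) (-x) x := by
        refine ((hasDerivAt_pow 2 x).neg.div_const 2).congr_deriv ?_
        norm_num
        ring
      exact h1.exp.congr_deriv (mul_comm _ _))
    (by
      convert (integrable_pow_mul_exp (k + 1)).neg using 1
      funext x
      simp
      ring)
    (by
      convert (integrable_pow_mul_exp (k - 1)).const_mul (k : ℝ) using 1
      funext x
      simp
      ring)
    (integrable_pow_mul_exp k)
  rw [← neg_eq_iff_eq_neg, ← integral_neg] at h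
  rw [← h]
  refine integral_congr_ae (Filter.Eventually.of_forall fun x => ?_)
  simp only
  ring

/-- Full support is what upgrades vanishing almost everywhere to vanishing everywhere for continuous
functions. -/
instance : (gaussianReal 0 1).IsOpenPosMeasure :=
  (gaussianReal_absolutelyContinuous' 0 one_ne_zero).isOpenPosMeasure

variable {τ : Type*} [Fintype τ]

theorem eval_monomial_eq_prod (s : τ →₀ ℕ) (c : ℝ) (x : τ → ℝ) :
    eval x (monomial s c) = c * ∏ t, x t ^ s t := by
  rw [eval_monomial, Finsupp.prod_fintype _ _ fun _ => pow_zero _]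

theorem integrable_eval_gaussian (p : MvPolynomial τ ℝ) :
    Integrable (fun x : τ → ℝ => eval x p) (Measure.pi fun _ => gaussianReal 0 1) := by
  induction p using MvPolynomial.induction_on' with
  | monomial s c =>
    simp only [eval_monomial_eq_prod]
    exact (Integrable.fintype_prod fun t => integrable_pow_gaussianReal (s t)).const_mul c
  | add p q hp hq =>
    simp only [map_add]
    exact hp.add hq

/-- The mean of a polynomial in independent standard Gaussian variables. -/
noncomputable def gaussianMean : MvPolynomial τ ℝ →ₗ[ℝ] ℝ where
  toFun p := ∫ x, eval x p ∂(Measure.pi fun _ => gaussianReal 0 1)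
  map_add' p q := by
    simp only [map_add]
    exact integral_add (integrable_eval_gaussian p) (integrable_eval_gaussian q)
  map_smul' c p := by
    simp only [smul_eval, RingHom.id_apply, smul_eq_mul]
    exact integral_const_mul _ _

theorem gaussianMean_monomial (s : τ →₀ ℕ) (c : ℝ) :
    gaussianMean (monomial s c) = c * ∏ t, ∫ x, x ^ s t ∂gaussianReal 0 1 := by
  simp only [gaussianMean, LinearMap.coe_mk, AddHom.coe_mk, eval_monomial_eq_prod]
  rw [integral_const_mul]
  congr 1
  exact integral_fintype_prod_eq_prod (fun t (x : ℝ) => x ^ s t)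

/-- Stein's identity. On monomials the mean is a product over the coordinates, and only the factor
at `t` changes. -/
theorem gaussianMean_X_mul (t : τ) (p : MvPolynomial τ ℝ) :
    gaussianMean (X t * p) = gaussianMean (pderiv t p) := by
  classical
  induction p using MvPolynomial.induction_on' with
  | monomial s c =>
    rw [pderiv_monomial, X, monomial_mul, one_mul, gaussianMean_monomial, gaussianMean_monomial,
      mul_assoc]
    congr 1
    rw [← Finset.mul_prod_erase _ _ (Finset.mem_univ t), ← Finset.mul_prod_erase _ _
      (Finset.mem_univ t), ← mul_assoc]
    congr 1
    · have h := integral_pow_succ_gaussianReal (s t)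
      rw [integral_const_mul] at h
      simpa [add_comm 1] using h
    · refine Finset.prod_congr rfl fun r hr => ?_
      have hr : t ≠ r := (Finset.ne_of_mem_erase hr).symm
      simp [Finsupp.single_eq_of_ne' hr]
  | add p q hp hq => rw [mul_add, map_add, map_add, hp, hq, map_add]

theorem eq_zero_of_gaussianMean_eq_zero {p : MvPolynomial τ ℝ} (h0 : ∀ x, 0 ≤ eval x p)
    (h : gaussianMean p = 0) : p = 0 := by
  have h1 := (integral_eq_zero_iff_of_nonneg h0 (integrable_eval_gaussian p)).1 h
  have h2 := (Continuous.ae_eq_iff_eq _ p.continuous_eval continuous_const).1 h1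
  exact MvPolynomial.funext fun x => (congrFun h2 x).trans (map_zero _).symm

/-- A harmonic eigenvector of the Euler operator with nonzero eigenvalue that takes no negative
value is zero. -/
theorem eq_zero_of_harmonic_of_nonneg {p : MvPolynomial τ ℝ} {d : ℕ} (hd : d ≠ 0)
    (hp : ∑ t, X t * pderiv t p = d • p) (hh : ∑ t, pderiv t (pderiv t p) = 0)
    (h0 : ∀ x, 0 ≤ eval x p) : p = 0 := by
  refine eq_zero_of_gaussianMean_eq_zero h0 ?_
  -- By Stein's identity the Euler operator and the Laplacian have the same mean, so `d` times the
  -- mean of `p` is zero.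
  have h := congrArg gaussianMean hp
  simp only [map_sum, gaussianMean_X_mul, map_nsmul] at h
  rw [← map_sum, hh, map_zero, nsmul_eq_mul] at h
  exact (mul_eq_zero.1 h.symm).resolve_left (Nat.cast_ne_zero.2 hd)

end MvPolynomial

/-! ### The Fischer form and linear substitutions -/

namespace MvPolynomial

section Fischer

variable {σ R S : Type*} [CommRing R] [CommRing S]

/-- The product of the factorials of the exponents. -/
def expFactorial (s : σ →₀ ℕ) : ℕ := s.prod fun _ k => k.factorial

theorem expFactorial_pos (s : σ →₀ ℕ) : 0 < expFactorial s :=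
  Finset.prod_pos fun _ _ => Nat.factorial_pos _

theorem expFactorial_add_single (s : σ →₀ ℕ) (x : σ) :
    expFactorial (s + Finsupp.single x 1) = (s x + 1) * expFactorial s := by
  classical
  have h (t : σ →₀ ℕ) := Finsupp.mul_prod_erase' t x (fun _ k => k.factorial)
    fun _ => Nat.factorial_zero
  have h1 : (s + Finsupp.single x 1).erase x = s.erase x := by
    rw [Finsupp.erase_add, Finsupp.erase_single, add_zero]
  rw [expFactorial, expFactorial, ← h, ← h s, h1]
  simp [Nat.factorial_succ, mul_assoc]

/-- The Fischer form, for which the monomials are orthogonal and multiplication by a variable is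
adjoint to the partial derivative. -/
noncomputable def fischer : MvPolynomial σ R →ₗ[R] MvPolynomial σ R →ₗ[R] R :=
  (basisMonomials σ R).constr R fun s => (expFactorial s : R) • lcoeff R s

theorem fischer_monomial (s : σ →₀ ℕ) (c : R) (q : MvPolynomial σ R) :
    fischer (monomial s c) q = c * (expFactorial s * coeff s q) := by
  have h : monomial s c = c • basisMonomials σ R s := by
    rw [coe_basisMonomials, smul_monomial, smul_eq_mul, mul_one]
  rw [h, map_smul, fischer, Module.Basis.constr_basis]
  simp

theorem fischer_C (c : R) (q : MvPolynomial σ R) : fischer (C c) q = c * coeff 0 q := by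
  rw [← monomial_zero', fischer_monomial]
  simp [expFactorial]

/-- The factor `s x + 1` gained by the factorial weight is exactly the one produced by
differentiation. -/
theorem fischer_X_mul (x : σ) (p q : MvPolynomial σ R) :
    fischer (X x * p) q = fischer p (pderiv x q) := by
  induction p using MvPolynomial.induction_on' with
  | monomial s c =>
    rw [X, monomial_mul, one_mul, fischer_monomial, fischer_monomial, coeff_pderiv, add_comm,
      expFactorial_add_single]
    push_cast
    ring
  | add p r hp hr => rw [mul_add, map_add, map_add, LinearMap.add_apply, LinearMap.add_apply, hp, hr]

theorem fischer_comm (p q : MvPolynomial σ R) : fischer p q = fischer q p := by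
  classical
  induction p using MvPolynomial.induction_on' with
  | monomial s c =>
    induction q using MvPolynomial.induction_on' with
    | monomial t d =>
      rw [fischer_monomial, fischer_monomial, coeff_monomial, coeff_monomial]
      split_ifs with h1 h2 h2
      · subst h1
        ring
      · exact absurd h1.symm h2
      · exact absurd h2.symm h1
      · simp
    | add p r hp hr => rw [map_add, map_add, LinearMap.add_apply, hp, hr]
  | add p r hp hr => rw [map_add, map_add, LinearMap.add_apply, hp, hr]

theorem fischer_map (φ : R →+* S) (p q : MvPolynomial σ R) :
    fischer (map φ p) (map φ q) = φ (fischer p q) := by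
  induction p using MvPolynomial.induction_on' with
  | monomial s c => simp [fischer_monomial, map_monomial, coeff_map]
  | add p r hp hr => simp [hp, hr]

theorem fischer_self_nonneg (p : MvPolynomial σ ℝ) : 0 ≤ fischer p p := by
  conv_rhs => enter [1]; rw [p.as_sum]
  simp only [map_sum, LinearMap.sum_apply, fischer_monomial]
  refine Finset.sum_nonneg fun s _ => ?_
  nlinarith [mul_nonneg (Nat.cast_nonneg (α := ℝ) (expFactorial s)) (mul_self_nonneg (coeff s p))]

/-- The form is a sum of squares with positive weights. It is bilinear, so this needs real
coefficients and fails over ℂ. -/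
theorem fischer_self_eq_zero {p : MvPolynomial σ ℝ} (h : fischer p p = 0) : p = 0 := by
  have h1 : fischer p p = ∑ s ∈ p.support, expFactorial s * (coeff s p * coeff s p) := by
    conv_lhs => enter [1]; rw [p.as_sum]
    simp only [map_sum, LinearMap.sum_apply, fischer_monomial]
    exact Finset.sum_congr rfl fun s _ => by ring
  rw [h1, Finset.sum_eq_zero_iff_of_nonneg fun s _ => mul_nonneg (Nat.cast_nonneg _)
    (mul_self_nonneg _)] at h
  ext s
  by_contra hs
  have := h s (mem_support_iff.2 hs)
  have h2 : (expFactorial s : ℝ) ≠ 0 := Nat.cast_ne_zero.2 (expFactorial_pos s).ne'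
  simp_all

end Fischer

section LinSubst

variable {ι κ R S : Type*} [Fintype ι] [CommRing R] [CommRing S]

/-- The substitution `X (i, k) ↦ ∑ⱼ g j i X (j, k)`. -/
noncomputable def linSubst (g : Matrix ι ι R) : MvPolynomial (ι × κ) R →ₐ[R] MvPolynomial (ι × κ) R :=
  aeval fun x => ∑ j, C (g j x.1) * X (j, x.2)

theorem linSubst_X (g : Matrix ι ι R) (i : ι) (k : κ) :
    linSubst g (X (i, k)) = ∑ j, C (g j i) * X (j, k) := aeval_X _ _

theorem linSubst_one [DecidableEq ι] : linSubst (κ := κ) (1 : Matrix ι ι R) = AlgHom.id R _ := by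
  apply algHom_ext
  rintro ⟨i, k⟩
  simp [linSubst_X, Matrix.one_apply, apply_ite]

theorem linSubst_mul (g h : Matrix ι ι R) (p : MvPolynomial (ι × κ) R) :
    linSubst (g * h) p = linSubst g (linSubst h p) := by
  suffices H : linSubst (g * h) = (linSubst (κ := κ) g).comp (linSubst h) from
    DFunLike.congr_fun H p
  apply algHom_ext
  rintro ⟨i, k⟩
  simp only [AlgHom.comp_apply, linSubst_X, map_sum, map_mul, algHom_C, algebraMap_eq,
    Matrix.mul_apply, Finset.sum_mul, Finset.mul_sum]
  rw [Finset.sum_comm]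
  refine Finset.sum_congr rfl fun j _ => Finset.sum_congr rfl fun l _ => ?_
  ring

theorem map_linSubst (φ : R →+* S) (g : Matrix ι ι R) (p : MvPolynomial (ι × κ) R) :
    map φ (linSubst g p) = linSubst (g.map φ) (map φ p) := by
  induction p using MvPolynomial.induction_on with
  | C a => simp
  | add p q hp hq => simp only [map_add, hp, hq]
  | mul_X p x hp =>
    obtain ⟨i, k⟩ := x
    simp only [map_mul, hp, map_X, linSubst_X, map_sum, map_C, Matrix.map_apply]

theorem pderiv_linSubst (g : Matrix ι ι R) (i : ι) (k : κ) (p : MvPolynomial (ι × κ) R) :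
    pderiv (i, k) (linSubst g p) = ∑ j, C (g i j) * linSubst g (pderiv (j, k) p) := by
  classical
  induction p using MvPolynomial.induction_on with
  | C a => simp
  | add p q hp hq => simp only [map_add, hp, hq, mul_add, Finset.sum_add_distrib]
  | mul_X p x hp =>
    obtain ⟨l, m⟩ := x
    have h1 : pderiv (i, k) (linSubst g (X (l, m))) = if k = m then C (g i l) else 0 := by
      simp only [linSubst_X, map_sum, pderiv_C_mul, pderiv_X, Pi.single_apply, Prod.mk.injEq]
      split_ifs with h
      · simp [h]
      · simp [Ne.symm h]
    have h2 : ∑ j, C (g i j) * linSubst g (pderiv (j, k) (X (l, m) : MvPolynomial (ι × κ) R)) =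
        if k = m then C (g i l) else 0 := by
      simp only [pderiv_X, Pi.single_apply, Prod.mk.injEq]
      split_ifs with h
      · simp [h, apply_ite]
      · simp [Ne.symm h]
    rw [map_mul, Derivation.leibniz, smul_eq_mul, smul_eq_mul, h1, hp, ← h2]
    simp only [Derivation.leibniz, map_add, smul_eq_mul, map_mul, mul_add, Finset.sum_add_distrib,
      Finset.mul_sum]
    exact congrArg₂ (· + ·) (Finset.sum_congr rfl fun j _ => mul_left_comm _ _ _)
      (Finset.sum_congr rfl fun j _ => mul_left_comm _ _ _)

theorem coeff_zero_linSubst (g : Matrix ι ι R) (p : MvPolynomial (ι × κ) R) :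
    coeff 0 (linSubst g p) = coeff 0 p := by
  simp only [← constantCoeff_eq]
  induction p using MvPolynomial.induction_on with
  | C a => simp
  | add p q hp hq => simp only [map_add, hp, hq]
  | mul_X p x hp =>
    obtain ⟨i, k⟩ := x
    simp [linSubst_X]

/-- Peel off one variable at a time: multiplication by a substituted variable is adjoint to the
corresponding combination of derivatives, which the chain rule identifies. -/
theorem fischer_linSubst (g : Matrix ι ι R) (p q : MvPolynomial (ι × κ) R) :
    fischer (linSubst g p) q = fischer p (linSubst g.transpose q) := by
  induction p using MvPolynomial.induction_on generalizing q with
  | C a => simp [fischer_C, coeff_zero_linSubst]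
  | add p r hp hr => simp only [map_add, LinearMap.add_apply, hp, hr]
  | mul_X p x hp =>
    obtain ⟨i, k⟩ := x
    rw [map_mul, mul_comm p, mul_comm, linSubst_X, fischer_X_mul, pderiv_linSubst]
    simp only [Finset.sum_mul, map_sum, LinearMap.sum_apply, C_mul', smul_mul_assoc,
      map_smul, LinearMap.smul_apply, fischer_X_mul, hp, Matrix.transpose_apply]

theorem isHomogeneous_linSubst (g : Matrix ι ι R) {p : MvPolynomial (ι × κ) R} {d : ℕ}
    (hp : p.IsHomogeneous d) : (linSubst g p).IsHomogeneous d := by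
  have h : ∀ x : ι × κ, (∑ j, C (g j x.1) * X (j, x.2) : MvPolynomial (ι × κ) R).IsHomogeneous 1 :=
    fun x => IsHomogeneous.sum _ _ _ fun j _ => (isHomogeneous_X _ _).C_mul _
  simpa only [one_mul, linSubst] using hp.aeval _ h

end LinSubst

end MvPolynomial

/-! ### The first fundamental theorem for the real orthogonal group -/

namespace MvPolynomial

set_option linter.unusedSectionVars false

variable {ι κ : Type*} [Fintype ι] [DecidableEq ι]

/-- Invariance under the orthogonal group. -/
def IsOrthInvariant {R : Type*} [CommRing R] (p : MvPolynomial (ι × κ) R) : Prop :=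
  ∀ g ∈ {g : Matrix ι ι R | g * g.transpose = 1}, linSubst g p = p

theorem pderiv_comm {σ R : Type*} [CommRing R] (x y : σ) (p : MvPolynomial σ R) :
    pderiv x (pderiv y p) = pderiv y (pderiv x p) := by
  classical
  have h : ⁅pderiv (R := R) x, pderiv y⁆ = (0 : Derivation R (MvPolynomial σ R) (MvPolynomial σ R)) := by
    refine derivation_ext fun z => ?_
    simp [Derivation.commutator_apply, pderiv_X, Pi.single_apply, apply_ite]
  have := DFunLike.congr_fun h p
  rwa [Derivation.commutator_apply, Derivation.zero_apply, sub_eq_zero] at this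

/-! ### Positivity of the matrix coefficient of an invariant. -/

section Positivity

open scoped MatrixOrder

/-- The positive factor in the polar decomposition of `G` is `r * r`; its own root `r` is needed to
turn `⟨r r p, p⟩` into a square. -/
theorem exists_symm_sq_sq (G : Matrix ι ι ℝ) :
    ∃ r : Matrix ι ι ℝ, r.transpose = r ∧ (r * r) * (r * r) = G * G.transpose := by
  have hA : 0 ≤ G * G.transpose := by
    rw [Matrix.nonneg_iff_posSemidef, ← Matrix.conjTranspose_eq_transpose_of_trivial]
    exact Matrix.posSemidef_self_mul_conjTranspose G
  have hP : 0 ≤ CFC.sqrt (G * G.transpose) := CFC.sqrt_nonneg _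
  refine ⟨CFC.sqrt (CFC.sqrt (G * G.transpose)), ?_, ?_⟩
  · have h := (Matrix.nonneg_iff_posSemidef.1
      (CFC.sqrt_nonneg (CFC.sqrt (G * G.transpose)))).isHermitian
    rwa [Matrix.IsHermitian, Matrix.conjTranspose_eq_transpose_of_trivial] at h
  · rw [CFC.sqrt_mul_sqrt_self _ hP, CFC.sqrt_mul_sqrt_self _ hA]

/-- Write `G = r r o` with `o` orthogonal. Then `o p = p`, and since `r` is symmetric, `⟨G p, p⟩ =
⟨r p, r p⟩ ≥ 0`. -/
theorem IsOrthInvariant.fischer_nonneg_of_det_ne_zero {p : MvPolynomial (ι × κ) ℝ}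
    (hp : IsOrthInvariant p) {G : Matrix ι ι ℝ} (hG : G.det ≠ 0) : 0 ≤ fischer (linSubst G p) p := by
  obtain ⟨r, hr, h⟩ := exists_symm_sq_sq G
  have hs : (r * r).transpose = r * r := by rw [Matrix.transpose_mul, hr]
  generalize hrs : r * r = s at h hs
  have hdet : IsUnit s.det := by
    have := congrArg Matrix.det h
    rw [Matrix.det_mul, Matrix.det_mul, Matrix.det_transpose] at this
    exact isUnit_iff_ne_zero.2 fun h0 => hG (by simpa [h0] using this.symm)
  have ho : (s⁻¹ * G) * (s⁻¹ * G).transpose = 1 := by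
    calc (s⁻¹ * G) * (s⁻¹ * G).transpose = s⁻¹ * (G * G.transpose) * s⁻¹ := by
          rw [Matrix.transpose_mul, Matrix.transpose_nonsing_inv, hs]
          simp only [Matrix.mul_assoc]
      _ = 1 := by
          rw [← h, ← Matrix.mul_assoc, Matrix.nonsing_inv_mul _ hdet, Matrix.one_mul,
            Matrix.mul_nonsing_inv _ hdet]
  have hsG : G = r * (r * (s⁻¹ * G)) := by
    rw [← Matrix.mul_assoc, hrs, ← Matrix.mul_assoc, Matrix.mul_nonsing_inv _ hdet, Matrix.one_mul]
  rw [hsG, linSubst_mul, linSubst_mul, hp _ ho, fischer_linSubst, hr]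
  exact fischer_self_nonneg _

/-- Extension to singular `G` by continuity along the line `G + t`, which is invertible for all but
finitely many `t`. -/
theorem IsOrthInvariant.fischer_nonneg {p : MvPolynomial (ι × κ) ℝ}
    (hp : IsOrthInvariant p) {F : Matrix ι ι ℝ → ℝ} (hF : Continuous F)
    (hFp : ∀ G, F G = fischer (linSubst G p) p) (G : Matrix ι ι ℝ) : 0 ≤ F G := by
  have hfin : {t : ℝ | (G + t • (1 : Matrix ι ι ℝ)).det = 0}.Finite := by
    refine ((-G).charpoly.rootSet_finite ℝ).subset fun t ht => ?_
    rw [Polynomial.mem_rootSet]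
    refine ⟨(Matrix.charpoly_monic _).ne_zero, ?_⟩
    rw [Polynomial.coe_aeval_eq_eval, Matrix.eval_charpoly]
    rw [Set.mem_ofPred_eq] at ht
    rw [← ht]
    congr 1
    ext i j
    simp [Matrix.one_apply, Matrix.diagonal_apply, Matrix.scalar_apply]
    ring
  have hdense := hfin.countable.dense_compl ℝ
  have hcl : IsClosed {t : ℝ | 0 ≤ F (G + t • (1 : Matrix ι ι ℝ))} :=
    isClosed_le continuous_const (hF.comp (by fun_prop))
  have huniv := hcl.closure_subset_iff.2 (fun t (ht : t ∈ {t : ℝ | _}ᶜ) => by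
    rw [Set.mem_ofPred_eq, hFp]
    exact hp.fischer_nonneg_of_det_ne_zero ht)
  rw [hdense.closure_eq] at huniv
  simpa using huniv (Set.mem_univ (0 : ℝ))

end Positivity

/-- The polarized Laplacian `∑ᵢ ∂²/∂X(i,k)∂X(i,l)`. -/
noncomputable def laplacian {R : Type*} [CommRing R] (k l : κ) :
    MvPolynomial (ι × κ) R →ₗ[R] MvPolynomial (ι × κ) R :=
  ∑ i, (pderiv (i, k)).toLinearMap ∘ₗ (pderiv (i, l)).toLinearMap

theorem laplacian_apply {R : Type*} [CommRing R] (k l : κ) (p : MvPolynomial (ι × κ) R) :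
    laplacian k l p = ∑ i, pderiv (i, k) (pderiv (i, l) p) := by
  simp [laplacian]

/-- The matrix coefficient `G ↦ ⟨G p, q⟩` of the Fischer form, as a polynomial in the entries
of `G`. -/
noncomputable def fischerCoeff : MvPolynomial (ι × κ) ℝ →ₗ[ℝ] MvPolynomial (ι × κ) ℝ →ₗ[ℝ]
    MvPolynomial (ι × ι) ℝ :=
  LinearMap.mk₂ ℝ (fun p q => fischer (linSubst (Matrix.mvPolynomialX ι ι ℝ) (map C p)) (map C q))
    (fun p p' q => by simp) (fun c p q => by
      simp only [smul_eq_C_mul, map_mul, map_C, algHom_C, algebraMap_eq]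
      simp only [C_mul', map_smul, LinearMap.smul_apply, smul_eq_mul])
    (fun p q q' => by simp) (fun c p q => by
      simp only [smul_eq_C_mul, map_mul, map_C]
      simp only [C_mul', map_smul, smul_eq_mul])

theorem fischerCoeff_apply (p q : MvPolynomial (ι × κ) ℝ) : fischerCoeff p q =
    fischer (linSubst (Matrix.mvPolynomialX ι ι ℝ) (map C p)) (map C q) := rfl

theorem eval_fischerCoeff (G : Matrix ι ι ℝ) (p q : MvPolynomial (ι × κ) ℝ) :
    eval (fun x => G x.1 x.2) (fischerCoeff p q) = fischer (linSubst G p) q := by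
  have h (r : MvPolynomial (ι × κ) ℝ) :
      map (eval fun x : ι × ι => G x.1 x.2) (map (C (σ := ι × ι)) r) = r := by
    rw [map_map]
    convert map_id r
    ext
    simp
  have hX : (Matrix.mvPolynomialX ι ι ℝ).map (eval fun x : ι × ι => G x.1 x.2) = G := by
    ext i j
    simp [Matrix.mvPolynomialX]
  rw [fischerCoeff_apply, ← fischer_map, map_linSubst, h, h, hX]

theorem fischerCoeff_X_mul (i : ι) (k : κ) (p q : MvPolynomial (ι × κ) ℝ) :
    fischerCoeff (X (i, k) * p) q = ∑ j, X (j, i) * fischerCoeff p (pderiv (j, k) q) := by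
  simp only [fischerCoeff_apply, map_mul, map_X, linSubst_X, Finset.sum_mul, map_sum,
    LinearMap.sum_apply, C_mul', smul_mul_assoc, map_smul, LinearMap.smul_apply, fischer_X_mul,
    pderiv_map, smul_eq_mul, Matrix.mvPolynomialX_apply]

variable [Fintype κ]

/-- The derivative of `G p` in the entry `(j, i)` is `∑ₖ X(j,k) G(∂_{(i,k)} p)`; adjunction moves
`X(j,k)` onto `q` as a derivative. The sum over `k` is the reason for a finite `κ`. -/
theorem pderiv_fischerCoeff (j i : ι) (p q : MvPolynomial (ι × κ) ℝ) :
    pderiv (j, i) (fischerCoeff p q) = ∑ k, fischerCoeff (pderiv (i, k) p) (pderiv (j, k) q) := by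
  classical
  induction p using MvPolynomial.induction_on generalizing q with
  | C a => simp [fischerCoeff_apply, fischer_C, coeff_map]
  | add p r hp hr => simp only [map_add, LinearMap.add_apply, hp, hr, Finset.sum_add_distrib]
  | mul_X p x hp =>
    obtain ⟨a, b⟩ := x
    rw [mul_comm, fischerCoeff_X_mul]
    simp only [map_sum, Derivation.leibniz, hp, smul_eq_mul, map_add, LinearMap.add_apply,
      fischerCoeff_X_mul, Finset.sum_add_distrib]
    congr 1
    · simp only [Finset.mul_sum]
      rw [Finset.sum_comm]
      refine Finset.sum_congr rfl fun k _ => Finset.sum_congr rfl fun l _ => ?_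
      rw [pderiv_comm]
    · simp only [pderiv_X, Pi.single_apply, Prod.mk.injEq]
      by_cases h : a = i
      · have h1 (k : κ) : fischerCoeff (if a = i ∧ b = k then p else 0) (pderiv (j, k) q) =
            if b = k then fischerCoeff p (pderiv (j, k) q) else 0 := by
          by_cases hb : b = k <;> simp [h, hb]
        simp only [mul_ite, mul_one, mul_zero, h1]
        simp [h]
      · simp [h]

end MvPolynomial

/-! ### Harmonic invariants vanish; quadrics span the invariants. -/

namespace MvPolynomial

set_option linter.unusedSectionVars false

variable {ι κ : Type*} [Fintype ι] [DecidableEq ι]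

theorem IsOrthInvariant.eq_zero_of_laplacian_eq_zero [Fintype κ] {p : MvPolynomial (ι × κ) ℝ}
    (hp : IsOrthInvariant p) {d : ℕ} (hd : d ≠ 0) (hpd : p.IsHomogeneous d)
    (h : ∀ k l, laplacian k l p = 0) : p = 0 := by
  have h0 : fischerCoeff p p = 0 := by
    refine eq_zero_of_harmonic_of_nonneg hd ?_ ?_ fun x => ?_
    -- The Euler operator in the entries of `G` acts as the Euler operator on the first argument.
    · have h1 := congrArg (fun q => fischerCoeff q p) hpd.sum_X_mul_pderiv
      simp only [map_sum, LinearMap.sum_apply, map_nsmul, LinearMap.smul_apply,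
        Fintype.sum_prod_type, fischerCoeff_X_mul] at h1
      rw [← h1]
      simp only [Fintype.sum_prod_type, pderiv_fischerCoeff, Finset.mul_sum]
      rw [Finset.sum_comm]
      exact Finset.sum_congr rfl fun i _ => Finset.sum_comm
    -- Differentiating twice in each entry, the Laplacian in `G` becomes `∑ₖₗ ⟨G Δₗₖ p, Δₗₖ p⟩`,
    -- every term of which is zero.
    · have h1 : ∀ k l, ∑ j, ∑ i, fischerCoeff (pderiv (i, l) (pderiv (i, k) p))
          (pderiv (j, l) (pderiv (j, k) p)) = 0 := fun k l => by
        rw [← map_zero (fischerCoeff (laplacian l k p)), ← h l k, laplacian_apply]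
        simp only [map_sum, LinearMap.sum_apply]
      simp only [Fintype.sum_prod_type, pderiv_fischerCoeff, map_sum]
      calc _ = ∑ k, ∑ l, ∑ j, ∑ i, fischerCoeff (pderiv (i, l) (pderiv (i, k) p))
            (pderiv (j, l) (pderiv (j, k) p)) := by
            simp only [Finset.sum_comm (s := (Finset.univ : Finset ι)) (t := (Finset.univ : Finset κ))]
        _ = 0 := by simp only [h1, Finset.sum_const_zero]
    · exact hp.fischer_nonneg (F := fun G => eval (fun x => G x.1 x.2) (fischerCoeff p p))
        ((fischerCoeff p p).continuous_eval.comp (by fun_prop))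
        (fun G => eval_fischerCoeff G p p) (Matrix.of fun i j => x (i, j))
  have h1 := eval_fischerCoeff 1 p p
  rw [h0, map_zero, linSubst_one] at h1
  exact fischer_self_eq_zero h1.symm

/-- Orthogonal projection: definiteness makes the form restricted to `W` nondegenerate, so it
represents the functional `⟨p, ·⟩` on `W`. -/
theorem exists_fischer_sub_eq_zero {σ : Type*} (W : Submodule ℝ (MvPolynomial σ ℝ))
    [FiniteDimensional ℝ W] (p : MvPolynomial σ ℝ) :
    ∃ w ∈ W, ∀ u ∈ W, fischer u (p - w) = 0 := by
  let φ : W →ₗ[ℝ] Module.Dual ℝ W := fischer.compl₁₂ W.subtype W.subtype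
  have hinj : Function.Injective φ := by
    refine (injective_iff_map_eq_zero φ).2 fun w hw => ?_
    exact Subtype.ext (fischer_self_eq_zero (DFunLike.congr_fun hw w))
  have hsurj := (LinearMap.injective_iff_surjective_of_finrank_eq_finrank
    (Subspace.dual_finrank_eq (K := ℝ) (V := W)).symm).1 hinj
  obtain ⟨w, hw⟩ := hsurj (fischer p ∘ₗ W.subtype)
  refine ⟨w, w.2, fun u hu => ?_⟩
  have h : fischer (w : MvPolynomial σ ℝ) u = fischer p u := DFunLike.congr_fun hw ⟨u, hu⟩
  rw [map_sub, fischer_comm u p, fischer_comm u, h, sub_self]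

section Quad

variable {R : Type*} [CommRing R]

/-- The quadratic invariant `∑ᵢ X(i,k) X(i,l)`. -/
noncomputable def quad (ι : Type*) [Fintype ι] (R : Type*) [CommRing R] (k l : κ) :
    MvPolynomial (ι × κ) R :=
  ∑ i, X (i, k) * X (i, l)

/-- The monomials of degree `d` in the quadratic invariants. -/
inductive IsQuadMonomial : ℕ → MvPolynomial (ι × κ) R → Prop
  | one : IsQuadMonomial 0 1
  | mul (k l : κ) {d : ℕ} {p : MvPolynomial (ι × κ) R} (hp : IsQuadMonomial d p) :
      IsQuadMonomial (d + 2) (quad ι R k l * p)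

theorem quad_comm (k l : κ) : quad ι R k l = quad ι R l k :=
  Finset.sum_congr rfl fun _ _ => mul_comm _ _

theorem isHomogeneous_quad (k l : κ) : (quad ι R k l).IsHomogeneous 2 :=
  IsHomogeneous.sum _ _ _ fun i _ => (isHomogeneous_X R (i, k)).mul (isHomogeneous_X R (i, l))

theorem isOrthInvariant_quad (k l : κ) : IsOrthInvariant (quad ι R k l) := by
  intro g hg
  have h1 : ∀ j m, ∑ i, g j i * g m i = if j = m then 1 else 0 := fun j m => by
    simpa [Matrix.mul_apply, Matrix.one_apply] using congrFun (congrFun hg j) m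
  calc linSubst g (quad ι R k l)
      = ∑ i, ∑ j, ∑ m, C (g j i * g m i) * (X (j, k) * X (m, l)) := by
        simp only [quad, map_sum, map_mul, linSubst_X, Finset.sum_mul_sum]
        refine Finset.sum_congr rfl fun i _ => Finset.sum_congr rfl fun j _ =>
          Finset.sum_congr rfl fun m _ => ?_
        ring
    _ = ∑ j, ∑ m, C (∑ i, g j i * g m i) * (X (j, k) * X (m, l)) := by
        rw [Finset.sum_comm]
        refine Finset.sum_congr rfl fun j _ => ?_
        rw [Finset.sum_comm]
        simp only [map_sum, Finset.sum_mul]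
    _ = quad ι R k l := by
        simp [h1, quad, apply_ite]

theorem IsOrthInvariant.mul {p q : MvPolynomial (ι × κ) R} (hp : IsOrthInvariant p)
    (hq : IsOrthInvariant q) : IsOrthInvariant (p * q) := fun g hg => by
  rw [map_mul, hp g hg, hq g hg]

theorem IsQuadMonomial.isOrthInvariant {d : ℕ} {p : MvPolynomial (ι × κ) R}
    (hp : IsQuadMonomial d p) : IsOrthInvariant p := by
  induction hp with
  | one => exact fun g _ => map_one _
  | mul k l _ ih => exact (isOrthInvariant_quad k l).mul ih

theorem IsQuadMonomial.isHomogeneous {d : ℕ} {p : MvPolynomial (ι × κ) R}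
    (hp : IsQuadMonomial d p) : p.IsHomogeneous d := by
  induction hp with
  | one => exact isHomogeneous_one _ _
  | mul k l _ ih => rw [add_comm]; exact (isHomogeneous_quad k l).mul ih

theorem IsQuadMonomial.rename {κ' : Type*} (f : κ → κ') {d : ℕ} {p : MvPolynomial (ι × κ) R}
    (hp : IsQuadMonomial d p) : IsQuadMonomial d (rename (Prod.map id f) p) := by
  induction hp with
  | one => simpa using IsQuadMonomial.one
  | mul k l _ ih =>
    rw [map_mul]
    convert ih.mul (f k) (f l) using 2
    simp [quad]

theorem IsQuadMonomial.map {S : Type*} [CommRing S] (φ : R →+* S) {d : ℕ}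
    {p : MvPolynomial (ι × κ) R} (hp : IsQuadMonomial d p) : IsQuadMonomial d (map φ p) := by
  induction hp with
  | one => simpa using IsQuadMonomial.one
  | mul k l _ ih =>
    rw [map_mul]
    convert ih.mul k l using 2
    simp [quad]

/-- The chain rule applied twice produces the entries of `gᵀ g = 1`. -/
theorem IsOrthInvariant.laplacian {p : MvPolynomial (ι × κ) R} (hp : IsOrthInvariant p) (k l : κ) :
    IsOrthInvariant (laplacian k l p) := by
  intro g hg
  have hg' : g.transpose * g = 1 := mul_eq_one_comm.1 hg
  have h1 : ∀ j m, ∑ i, g i j * g i m = if j = m then 1 else 0 := fun j m => by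
    simpa [Matrix.mul_apply, Matrix.one_apply] using congrFun (congrFun hg' j) m
  symm
  calc MvPolynomial.laplacian k l p = MvPolynomial.laplacian k l (linSubst g p) := by rw [hp g hg]
    _ = ∑ i, ∑ j, ∑ m, C (g i j * g i m) * linSubst g (pderiv (m, k) (pderiv (j, l) p)) := by
        simp only [laplacian_apply, pderiv_linSubst, map_sum, pderiv_C_mul, Finset.mul_sum, map_mul,
          mul_assoc]
    _ = ∑ j, ∑ m, C (∑ i, g i j * g i m) * linSubst g (pderiv (m, k) (pderiv (j, l) p)) := by
        rw [Finset.sum_comm]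
        refine Finset.sum_congr rfl fun j _ => ?_
        rw [Finset.sum_comm]
        simp only [map_sum, Finset.sum_mul]
    _ = linSubst g (MvPolynomial.laplacian k l p) := by
        simp [h1, laplacian_apply, apply_ite]

theorem fischer_quad_mul (k l : κ) (p q : MvPolynomial (ι × κ) R) :
    fischer (quad ι R l k * p) q = fischer p (laplacian k l q) := by
  simp only [quad, Finset.sum_mul, map_sum, LinearMap.sum_apply, laplacian_apply, mul_assoc,
    fischer_X_mul]

theorem IsHomogeneous.laplacian {p : MvPolynomial (ι × κ) R} {d : ℕ} (hp : p.IsHomogeneous d)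
    (k l : κ) : (laplacian k l p).IsHomogeneous (d - 2) := by
  rw [laplacian_apply]
  exact IsHomogeneous.sum _ _ _ fun i _ => hp.pderiv.pderiv

theorem laplacian_eq_zero_of_isHomogeneous {p : MvPolynomial (ι × κ) R} {d : ℕ}
    (hp : p.IsHomogeneous d) (hd : d < 2) (k l : κ) : laplacian k l p = 0 := by
  rw [laplacian_apply]
  refine Finset.sum_eq_zero fun i _ => ?_
  have h : (pderiv (i, l) p).IsHomogeneous 0 := by
    have := hp.pderiv (i := (i, l))
    rwa [show d - 1 = 0 by omega] at this
  rw [← totalDegree_zero_iff_isHomogeneous, totalDegree_eq_zero_iff_eq_C] at h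
  rw [h, pderiv_C]

/-- The orthogonal invariants. -/
def orthInvariants (ι κ R : Type*) [Fintype ι] [DecidableEq ι] [CommRing R] :
    Submodule R (MvPolynomial (ι × κ) R) where
  carrier := {p | IsOrthInvariant p}
  zero_mem' _ _ := map_zero _
  add_mem' hp hq g hg := by rw [map_add, hp g hg, hq g hg]
  smul_mem' c p hp g hg := by rw [map_smul, hp g hg]

end Quad

/-- Induction on the degree. Remove from `p` its projection onto the quadrics times invariants of
degree `d - 2`; the remainder is harmonic, hence zero. -/
theorem IsOrthInvariant.mem_span_of_fintype [Fintype κ] {p : MvPolynomial (ι × κ) ℝ}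
    (hp : IsOrthInvariant p) {d : ℕ} (hd : p.IsHomogeneous d) :
    p ∈ Submodule.span ℝ {q | IsQuadMonomial d q} := by
  induction d using Nat.strong_induction_on generalizing p with
  | _ d ih =>
  rcases Nat.eq_zero_or_pos d with rfl | hd0
  · rw [← totalDegree_zero_iff_isHomogeneous, totalDegree_eq_zero_iff_eq_C] at hd
    rw [hd, ← mul_one (C _), C_mul']
    exact Submodule.smul_mem _ _ (Submodule.subset_span .one)
  let W : Submodule ℝ (MvPolynomial (ι × κ) ℝ) := Submodule.span ℝ {w | ∃ k l e u, e + 2 = d ∧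
    IsOrthInvariant u ∧ u.IsHomogeneous e ∧ w = quad ι ℝ k l * u}
  have hWh : W ≤ homogeneousSubmodule (ι × κ) ℝ d := Submodule.span_le.2 (by
    rintro _ ⟨k, l, e, u, rfl, -, hu, rfl⟩
    rw [add_comm]
    exact (isHomogeneous_quad k l).mul hu)
  have hWi : W ≤ orthInvariants ι κ ℝ := Submodule.span_le.2 (by
    rintro _ ⟨k, l, e, u, -, hu, -, rfl⟩
    exact (isOrthInvariant_quad k l).mul hu)
  have hWq : W ≤ Submodule.span ℝ {q | IsQuadMonomial d q} := Submodule.span_le.2 (by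
    rintro _ ⟨k, l, e, u, rfl, hu, hue, rfl⟩
    have h1 := ih e (by omega) hu hue
    have h2 := Submodule.mem_map_of_mem (f := LinearMap.mulLeft ℝ (quad ι ℝ k l)) h1
    rw [Submodule.map_span] at h2
    refine Submodule.span_mono ?_ h2
    rintro _ ⟨q, hq, rfl⟩
    exact hq.mul k l)
  have : FiniteDimensional ℝ (homogeneousSubmodule (ι × κ) ℝ d) :=
    Module.Finite.iff_fg.2 (homogeneousSubmodule_fg _ _ _)
  have : FiniteDimensional ℝ W := Submodule.finiteDimensional_of_le hWh
  obtain ⟨w, hw, horth⟩ := exists_fischer_sub_eq_zero W p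
  have h0 : p - w = 0 := by
    have hi : IsOrthInvariant (p - w) := (orthInvariants ι κ ℝ).sub_mem hp (hWi hw)
    have hh : (p - w).IsHomogeneous d := (homogeneousSubmodule (ι × κ) ℝ d).sub_mem hd (hWh hw)
    refine hi.eq_zero_of_laplacian_eq_zero hd0.ne' hh fun k l => ?_
    rcases lt_or_ge d 2 with h2 | h2
    · exact laplacian_eq_zero_of_isHomogeneous hh h2 k l
    -- The square norm of the Laplacian of `p - w` is the pairing of `p - w` with a quadric times
    -- that Laplacian, which is an element of `W`.
    · refine fischer_self_eq_zero ?_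
      rw [← fischer_quad_mul]
      exact horth _ (Submodule.subset_span
        ⟨l, k, d - 2, _, by omega, hi.laplacian k l, hh.laplacian k l, rfl⟩)
  rw [sub_eq_zero.1 h0]
  exact hWq hw

/-! ### Infinitely many vectors and complex coefficients. -/

theorem rename_linSubst {κ' R : Type*} [CommRing R] (f : κ → κ') (g : Matrix ι ι R)
    (p : MvPolynomial (ι × κ) R) :
    rename (Prod.map id f) (linSubst g p) = linSubst g (rename (Prod.map id f) p) := by
  induction p using MvPolynomial.induction_on with
  | C a => simp
  | add p q hp hq => simp only [map_add, hp, hq]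
  | mul_X p x hp =>
    obtain ⟨i, k⟩ := x
    simp only [map_mul, hp, rename_X, Prod.map_apply, id, linSubst_X, map_sum, rename_C]

/-- The first fundamental theorem of invariant theory for the real orthogonal group. -/
theorem IsOrthInvariant.mem_span_real {p : MvPolynomial (ι × κ) ℝ}
    (hp : IsOrthInvariant p) {d : ℕ} (hd : p.IsHomogeneous d) :
    p ∈ Submodule.span ℝ {q | IsQuadMonomial d q} := by
  classical
  -- Only finitely many second indices occur in `p`, so it comes from a polynomial over the finite
  -- index type `s`.
  obtain ⟨s, hs⟩ : ∃ s : Finset κ, ∀ x ∈ p.vars, x.2 ∈ s :=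
    ⟨p.vars.image Prod.snd, fun x hx => Finset.mem_image_of_mem _ hx⟩
  have hf : Function.Injective (Prod.map (id : ι → ι) ((↑) : s → κ)) :=
    Function.injective_id.prodMap Subtype.val_injective
  obtain ⟨q, rfl⟩ := exists_rename_eq_of_vars_subset_range p _ hf (by
    rintro ⟨i, k⟩ h
    exact ⟨(i, ⟨k, hs _ h⟩), rfl⟩)
  have hq : IsOrthInvariant q := fun g hg => rename_injective _ hf (by
    rw [rename_linSubst, hp g hg])
  have h := Submodule.mem_map_of_mem (f := (rename (R := ℝ) (Prod.map id ((↑) : s → κ))).toLinearMap)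
    (hq.mem_span_of_fintype ((IsHomogeneous.rename_isHomogeneous_iff hf).1 hd))
  rw [Submodule.map_span] at h
  refine Submodule.span_mono ?_ h
  rintro _ ⟨r, hr, rfl⟩
  exact hr.rename _

theorem exists_eq_map_ofReal_add {σ : Type*} (p : MvPolynomial σ ℂ) :
    ∃ a b : MvPolynomial σ ℝ, p = map Complex.ofRealHom a + C Complex.I * map Complex.ofRealHom b := by
  induction p using MvPolynomial.induction_on' with
  | monomial s c =>
    refine ⟨monomial s c.re, monomial s c.im, ?_⟩
    rw [map_monomial, map_monomial, C_mul_monomial, ← map_add]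
    congr 1
    rw [mul_comm]
    exact (Complex.re_add_im c).symm
  | add p q hp hq =>
    obtain ⟨a, b, rfl⟩ := hp
    obtain ⟨a', b', rfl⟩ := hq
    exact ⟨a + a', b + b', by simp only [map_add]; ring⟩

theorem coeff_map_ofReal_add {σ : Type*} (a b : MvPolynomial σ ℝ) (s : σ →₀ ℕ) :
    coeff s (map Complex.ofRealHom a + C Complex.I * map Complex.ofRealHom b) =
      ⟨coeff s a, coeff s b⟩ := by
  rw [coeff_add, coeff_C_mul, coeff_map, coeff_map]
  apply Complex.ext <;> simp

/-- The first fundamental theorem of invariant theory for the complex orthogonal group. -/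
theorem IsOrthInvariant.mem_span_complex {p : MvPolynomial (ι × κ) ℂ}
    (hp : IsOrthInvariant p) {d : ℕ} (hd : p.IsHomogeneous d) :
    p ∈ Submodule.span ℂ {q | IsQuadMonomial d q} := by
  obtain ⟨a, b, rfl⟩ := exists_eq_map_ofReal_add p
  have hab : IsOrthInvariant a ∧ IsOrthInvariant b := by
    -- Real orthogonal matrices already suffice: their substitutions respect real and imaginary
    -- parts, so both parts are invariant.
    have h : ∀ g ∈ {g : Matrix ι ι ℝ | g * g.transpose = 1}, linSubst g a = a ∧ linSubst g b = b := by
      intro g hg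
      have h1 := hp (g.map Complex.ofRealHom) (by
        rw [Set.mem_ofPred_eq, ← Matrix.transpose_map, ← Matrix.map_mul, hg]
        simp)
      rw [map_add, map_mul, ← map_linSubst, ← map_linSubst, algHom_C, algebraMap_eq] at h1
      have h2 := fun s => congrArg (coeff s) h1
      simp only [coeff_map_ofReal_add, Complex.mk.injEq] at h2
      exact ⟨ext _ _ fun s => (h2 s).1, ext _ _ fun s => (h2 s).2⟩
    exact ⟨fun g hg => (h g hg).1, fun g hg => (h g hg).2⟩
  have hda : a.IsHomogeneous d := fun s hs => hd (by
    rw [coeff_map_ofReal_add]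
    exact fun h => hs (congrArg Complex.re h))
  have hdb : b.IsHomogeneous d := fun s hs => hd (by
    rw [coeff_map_ofReal_add]
    exact fun h => hs (congrArg Complex.im h))
  have hmap : ∀ {q : MvPolynomial (ι × κ) ℝ}, q ∈ Submodule.span ℝ {q | IsQuadMonomial d q} →
      map Complex.ofRealHom q ∈ Submodule.span ℂ {q | IsQuadMonomial d q} := by
    intro q hq
    induction hq using Submodule.span_induction with
    | mem r hr =>
      exact Submodule.subset_span (IsQuadMonomial.map _ hr)
    | zero => simp
    | add r r' _ _ h h' => rw [map_add]; exact Submodule.add_mem _ h h'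
    | smul c r _ h =>
      rw [smul_eq_C_mul, map_mul, map_C, C_mul']
      exact Submodule.smul_mem _ _ h
  refine Submodule.add_mem _ (hmap (hab.1.mem_span_real hda)) ?_
  rw [C_mul']
  exact Submodule.smul_mem _ _ (hmap (hab.2.mem_span_real hdb))

end MvPolynomial

/-! ### Locality and Dong's lemma -/

namespace QOA

set_option linter.unusedSectionVars false

open VertexOperator

/-! ### Multiplication by `z - w` as a difference operator on modes. -/

section ShiftDifference

variable {G W : Type*} [AddCommGroup G] [AddCommGroup W] [Module ℂ W]

/-- The difference of the translations by `g` and by `h` on functions on an abelian group. -/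
def shiftSub (g h : G) : Module.End ℂ (G → W) where
  toFun f x := f (x + g) - f (x + h)
  map_add' f f' := by
    funext x
    simp only [Pi.add_apply]
    abel
  map_smul' c f := by
    funext x
    simp only [Pi.smul_apply, RingHom.id_apply, smul_sub]

theorem shiftSub_apply (g h : G) (f : G → W) (x : G) :
    shiftSub g h f x = f (x + g) - f (x + h) := rfl

theorem commute_shiftSub (g h g' h' : G) :
    Commute (shiftSub (W := W) g h) (shiftSub g' h') := by
  refine LinearMap.ext fun f => funext fun x => ?_
  simp only [Module.End.mul_apply, shiftSub_apply, add_right_comm x g, add_right_comm x h]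
  abel

theorem shiftSub_sub_shiftSub (g h k : G) :
    shiftSub (W := W) g k - shiftSub g h = shiftSub h k := by
  refine LinearMap.ext fun f => funext fun x => ?_
  simp only [LinearMap.sub_apply, Pi.sub_apply, shiftSub_apply]
  abel

theorem pow_apply_eq_zero_of_le {M : Type*} [AddCommGroup M] [Module ℂ M] {x : Module.End ℂ M}
    {v : M} {N N' : ℕ} (h : (x ^ N) v = 0) (hN : N ≤ N') : (x ^ N') v = 0 := by
  rw [← Nat.sub_add_cancel hN, pow_add, Module.End.mul_apply, h, map_zero]

/-- Each term in the expansion of `(x - y) ^ (a + b)` contains `x ^ a` or `y ^ b`. -/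
theorem sub_pow_apply_eq_zero {M : Type*} [AddCommGroup M] [Module ℂ M] {x y : Module.End ℂ M}
    (hxy : Commute x y) {v : M} {a b : ℕ} (ha : (x ^ a) v = 0) (hb : (y ^ b) v = 0) :
    ((x - y) ^ (a + b)) v = 0 := by
  induction h : a + b generalizing a b v with
  | zero =>
    obtain rfl : a = 0 := by omega
    simpa using ha
  | succ m ih =>
    rcases Nat.eq_zero_or_pos a with rfl | ha0
    · have : v = 0 := by simpa using ha
      rw [this, map_zero]
    rcases Nat.eq_zero_or_pos b with rfl | hb0
    · have : v = 0 := by simpa using hb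
      rw [this, map_zero]
    have hx : ((x - y) ^ m) (x v) = 0 := by
      refine ih (a := a - 1) (b := b) ?_ ?_ (by omega)
      · rw [← Module.End.mul_apply, ← pow_succ, Nat.sub_add_cancel ha0, ha]
      · rw [← Module.End.mul_apply, ← (hxy.pow_right b).eq, Module.End.mul_apply, hb, map_zero]
    have hy : ((x - y) ^ m) (y v) = 0 := by
      refine ih (a := a) (b := b - 1) ?_ ?_ (by omega)
      · rw [← Module.End.mul_apply, (hxy.pow_left a).eq, Module.End.mul_apply, ha, map_zero]
      · rw [← Module.End.mul_apply, ← pow_succ, Nat.sub_add_cancel hb0, hb]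
    rw [pow_succ, Module.End.mul_apply, LinearMap.sub_apply, map_sub, hx, hy, sub_zero]

theorem shiftSub_pow_comp {H W' : Type*} [AddCommGroup H] [AddCommGroup W'] [Module ℂ W']
    {g h : G} {g' h' : H} (Λ : (G → W) →ₗ[ℂ] (H → W'))
    (hΛ : ∀ f, shiftSub g' h' (Λ f) = Λ (shiftSub g h f)) (N : ℕ) (f : G → W) :
    (shiftSub g' h' ^ N) (Λ f) = Λ ((shiftSub g h ^ N) f) := by
  induction N generalizing f with
  | zero => simp
  | succ N ih => rw [pow_succ, pow_succ, Module.End.mul_apply, Module.End.mul_apply, hΛ, ih]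

variable {V : Type*} [AddCommGroup V] [Module ℂ V]

/-- `H` is the pointwise finite sum of the family `F`. -/
def IsPointwiseSum (F : ℕ → G → Module.End ℂ V) (H : G → Module.End ℂ V) : Prop :=
  ∀ x v, (Function.support fun j => F j x v).Finite ∧ H x v = ∑ᶠ j, F j x v

theorem IsPointwiseSum.shiftSub {F : ℕ → G → Module.End ℂ V} {H : G → Module.End ℂ V}
    (h : IsPointwiseSum F H) (g g' : G) :
    IsPointwiseSum (fun j => shiftSub g g' (F j)) (shiftSub g g' H) := by
  intro x v
  refine ⟨((h (x + g) v).1.union (h (x + g') v).1).subset (Function.support_sub _ _), ?_⟩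
  simp only [shiftSub_apply, LinearMap.sub_apply]
  rw [(h _ v).2, (h _ v).2, finsum_sub_distrib (h _ v).1 (h _ v).1]

theorem IsPointwiseSum.shiftSub_pow {F : ℕ → G → Module.End ℂ V} {H : G → Module.End ℂ V}
    (h : IsPointwiseSum F H) (g g' : G) (N : ℕ) :
    IsPointwiseSum (fun j => (QOA.shiftSub g g' ^ N) (F j)) ((QOA.shiftSub g g' ^ N) H) := by
  induction N with
  | zero => simpa using h
  | succ N ih =>
    simp only [pow_succ', Module.End.mul_apply]
    exact ih.shiftSub g g'

theorem IsPointwiseSum.eq_zero {H : G → Module.End ℂ V} {F : ℕ → G → Module.End ℂ V}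
    (h : IsPointwiseSum F H) (h0 : ∀ j, F j = 0) : H = 0 := by
  refine funext fun x => LinearMap.ext fun v => ?_
  rw [(h x v).2]
  simp [h0]

end ShiftDifference

variable {V : Type*} [AddCommGroup V] [Module ℂ V]

/-- Mutual locality of two fields: `(z-w)ᴺ [a(z), b(w)] = 0` for some `N`. -/
def IsLocal (a b : VertexOperator ℂ V) : Prop :=
  ∃ N : ℕ, (shiftSub ((1, 0) : ℤ × ℤ) (0, 1) ^ N) (fun x => ⁅ncoeff a x.1, ncoeff b x.2⁆) = 0

theorem IsLocal.symm {a b : VertexOperator ℂ V} (h : IsLocal a b) : IsLocal b a := by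
  obtain ⟨N, hN⟩ := h
  refine ⟨N, ?_⟩
  let Λ : (ℤ × ℤ → Module.End ℂ V) →ₗ[ℂ] (ℤ × ℤ → Module.End ℂ V) :=
    LinearMap.funLeft ℂ _ Prod.swap
  have h1 := shiftSub_pow_comp (g := ((1, 0) : ℤ × ℤ)) (h := (0, 1)) (g' := ((0, 1) : ℤ × ℤ))
    (h' := (1, 0)) Λ (fun f => rfl) N fun x => ⁅ncoeff a x.1, ncoeff b x.2⁆
  rw [hN, map_zero] at h1
  have h2 : (shiftSub ((0, 1) : ℤ × ℤ) (1, 0) : Module.End ℂ (ℤ × ℤ → Module.End ℂ V)) =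
      (-1 : ℂ) • shiftSub (1, 0) (0, 1) := by
    refine LinearMap.ext fun f => funext fun x => ?_
    simp [shiftSub_apply]
  have h3 : Λ (fun x => ⁅ncoeff a x.1, ncoeff b x.2⁆) = -fun x => ⁅ncoeff b x.1, ncoeff a x.2⁆ :=
    funext fun x => by
      simp [Λ, LinearMap.funLeft_apply, Ring.lie_def]
  rw [h2, h3, map_neg, smul_pow, LinearMap.smul_apply, neg_eq_zero] at h1
  exact (smul_eq_zero.1 h1).resolve_left (pow_ne_zero _ (by norm_num))

theorem isLocal_zero (b : VertexOperator ℂ V) : IsLocal 0 b :=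
  ⟨0, funext fun x => by simp [Ring.lie_def]⟩

theorem isLocal_one (b : VertexOperator ℂ V) : IsLocal one b := by
  refine ⟨0, funext fun x => ?_⟩
  simp only [pow_zero, Module.End.one_apply, one, ncoeff_ofModes, Pi.zero_apply]
  split_ifs <;> simp [Ring.lie_def]

theorem IsLocal.add {a a' b : VertexOperator ℂ V} (h : IsLocal a b) (h' : IsLocal a' b) :
    IsLocal (a + a') b := by
  obtain ⟨N, hN⟩ := h
  obtain ⟨N', hN'⟩ := h'
  refine ⟨max N N', ?_⟩
  have := congrArg₂ (· + ·) (pow_apply_eq_zero_of_le hN (le_max_left N N'))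
    (pow_apply_eq_zero_of_le hN' (le_max_right N N'))
  simp only [← map_add, add_zero] at this
  rw [← this]
  congr 1
  funext x
  simp only [map_add, Pi.add_apply, Ring.lie_def, add_mul, mul_add]
  abel

theorem IsLocal.smul {a b : VertexOperator ℂ V} (h : IsLocal a b) (c : ℂ) : IsLocal (c • a) b := by
  obtain ⟨N, hN⟩ := h
  refine ⟨N, ?_⟩
  have := congrArg (c • ·) hN
  simp only [← map_smul, smul_zero] at this
  rw [← this]
  congr 1
  funext x
  simp [Ring.lie_def, smul_sub]

/-! ### Sums with binomial coefficients -/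

/-- The coefficient `(-1)ʲ (n choose j)`. -/
def signedChoose (n : ℤ) (j : ℕ) : ℂ := (-1) ^ j * ((Ring.choose n j : ℤ) : ℂ)

theorem signedChoose_zero (n : ℤ) : signedChoose n 0 = 1 := by simp [signedChoose]

theorem signedChoose_succ_succ (n : ℤ) (j : ℕ) :
    signedChoose (n + 1) (j + 1) = signedChoose n (j + 1) - signedChoose n j := by
  simp only [signedChoose, Ring.choose_succ_succ]
  push_cast
  ring

theorem signedChoose_succ_mul (n : ℤ) (j : ℕ) :
    signedChoose n (j + 1) * (j + 1) = -(signedChoose n j * (n - j)) := by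
  have h : ((Ring.choose n (j + 1) : ℤ) : ℂ) * (j + 1) = (Ring.choose n j : ℤ) * (n - j) := by
    have := Ring.choose_smul_choose n (Nat.le_succ j)
    rw [Nat.choose_succ_self_right, Nat.succ_eq_add_one, Nat.add_sub_cancel_left,
      Ring.choose_one_right, nsmul_eq_mul] at this
    have h2 := congrArg (Int.cast : ℤ → ℂ) this
    push_cast at h2
    rw [mul_comm, h2]
  simp only [signedChoose, pow_succ]
  linear_combination (-1) ^ j * (-1) * h

theorem finsum_eq_sum_range {P : ℕ → V} {N : ℕ} (hP : ∀ j ≥ N, P j = 0) :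
    ∑ᶠ j, P j = ∑ j ∈ Finset.range N, P j :=
  finsum_eq_sum_of_support_subset _ fun j hj => by
    simp only [Finset.coe_range, Set.mem_Iio]
    by_contra h
    exact hj (hP j (not_lt.1 h))

/-- Summation by parts with Pascal's rule; in series form, `(z-w)ⁿ⁺¹ = (z-w) (z-w)ⁿ`. -/
theorem finsum_signedChoose_succ (n : ℤ) {P : ℕ → V} {N : ℕ} (hP : ∀ j ≥ N, P j = 0) :
    ∑ᶠ j, signedChoose (n + 1) j • P j = ∑ᶠ j, signedChoose n j • (P j - P (j + 1)) := by
  rw [finsum_eq_sum_range (N := N + 1) fun j hj => by rw [hP j (by omega), smul_zero],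
    finsum_eq_sum_range (N := N + 1) fun j hj => by
      rw [hP j (by omega), hP (j + 1) (by omega), sub_zero, smul_zero] ]
  simp only [smul_sub, Finset.sum_sub_distrib]
  rw [Finset.sum_range_succ', Finset.sum_range_succ' (fun j => signedChoose n j • P j),
    Finset.sum_range_succ (fun j => signedChoose n j • P (j + 1)), hP (N + 1) (by omega), smul_zero,
    add_zero]
  simp only [signedChoose_succ_succ, sub_smul, Finset.sum_sub_distrib, signedChoose_zero]
  abel

/-- The sum telescopes. It is the coefficient form of `(∂_z + ∂_w) (z-w)ⁿ = 0`. -/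
theorem finsum_signedChoose_mul (n : ℤ) {P : ℕ → V} {N : ℕ} (hP : ∀ j ≥ N, P j = 0) :
    ∑ᶠ j, signedChoose n j • (((n : ℂ) - j) • P (j + 1) + (j : ℂ) • P j) = 0 := by
  rw [finsum_eq_sum_range (N := N + 1) fun j hj => by
      rw [hP j (by omega), hP (j + 1) (by omega)]; simp]
  simp only [smul_add, Finset.sum_add_distrib, smul_smul]
  rw [Finset.sum_range_succ, Finset.sum_range_succ', hP (N + 1) (by omega)]
  simp only [Nat.cast_add, Nat.cast_one, signedChoose_succ_mul, neg_smul, Finset.sum_neg_distrib]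
  simp

end QOA

namespace QOA

open VertexOperator

variable {V : Type*} [AddCommGroup V] [Module ℂ V]

/-! ### Dong's lemma -/

/-- The `j`-th term of the coefficient of `z ^ (-M-1) w ^ (-K-1)` in
`a(z) b(w) ι_{|z|>|w|} (z-w)ⁿ - b(w) a(z) ι_{|w|>|z|} (z-w)ⁿ`. -/
noncomputable def brTerm (n : ℤ) (a b : VertexOperator ℂ V) (x : ℤ × ℤ) (j : ℕ) : Module.End ℂ V :=
  signedChoose n j • (ncoeff a (x.1 + n - j) * ncoeff b (x.2 + j) -
    ((-1 : ℂ) ^ n) • (ncoeff b (x.2 + n - j) * ncoeff a (x.1 + j)))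

theorem exists_nat_ncoeff_eq_zero (a : VertexOperator ℂ V) (m : ℤ) (v : V) :
    ∃ N : ℕ, ∀ j : ℕ, j ≥ N → ncoeff a (m + j) v = 0 := by
  obtain ⟨N, hN⟩ := exists_ncoeff_eq_zero a v
  exact ⟨(N - m).toNat, fun j hj => hN _ (by omega)⟩

theorem exists_nat_mul_ncoeff_eq_zero (a b : VertexOperator ℂ V) (x : ℤ × ℤ) (v : V) :
    ∃ N : ℕ, ∀ j : ℕ, j ≥ N → ncoeff b (x.2 + j) v = 0 ∧ ncoeff a (x.1 + j) v = 0 := by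
  obtain ⟨N, hN⟩ := exists_nat_ncoeff_eq_zero b x.2 v
  obtain ⟨N', hN'⟩ := exists_nat_ncoeff_eq_zero a x.1 v
  exact ⟨max N N', fun j hj => ⟨hN j (le_trans (le_max_left _ _) hj),
    hN' j (le_trans (le_max_right _ _) hj)⟩⟩

theorem finite_support_brTerm (n : ℤ) (a b : VertexOperator ℂ V) (x : ℤ × ℤ) (v : V) :
    (Function.support fun j => brTerm n a b x j v).Finite := by
  obtain ⟨N, hN⟩ := exists_nat_mul_ncoeff_eq_zero a b x v
  refine (Set.finite_lt_nat N).subset fun j hj => ?_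
  by_contra hlt
  obtain ⟨h1, h2⟩ := hN j (not_lt.1 hlt)
  exact hj (by simp [brTerm, h1, h2])

/-- The coefficient of `z ^ (-M-1) w ^ (-K-1)` in
`a(z) b(w) ι_{|z|>|w|} (z-w)ⁿ - b(w) a(z) ι_{|w|>|z|} (z-w)ⁿ`, where `x = (M, K)`. -/
noncomputable def brMode (n : ℤ) (a b : VertexOperator ℂ V) (x : ℤ × ℤ) : Module.End ℂ V where
  toFun v := ∑ᶠ j : ℕ, brTerm n a b x j v
  map_add' v w := by
    simp only [map_add]
    exact finsum_add_distrib (finite_support_brTerm n a b x v) (finite_support_brTerm n a b x w)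
  map_smul' c v := by
    simp only [map_smul, RingHom.id_apply]
    exact (smul_finsum c _).symm

theorem brMode_apply (n : ℤ) (a b : VertexOperator ℂ V) (x : ℤ × ℤ) (v : V) :
    brMode n a b x v = ∑ᶠ j : ℕ, brTerm n a b x j v := rfl

/-- Taking the residue in `z` selects the first index `0`. -/
theorem brMode_eq_ncoeff_circ (n : ℤ) (a b : VertexOperator ℂ V) (m : ℤ) :
    brMode n a b (0, m) = ncoeff (circ n a b) m := by
  refine LinearMap.ext fun v => ?_
  rw [ncoeff_circ, brMode_apply]
  exact finsum_congr fun j => by simp [brTerm, circTerm, signedChoose]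

theorem brMode_zero (a b : VertexOperator ℂ V) (x : ℤ × ℤ) :
    brMode 0 a b x = ⁅ncoeff a x.1, ncoeff b x.2⁆ := by
  refine LinearMap.ext fun v => ?_
  rw [brMode_apply, finsum_eq_single _ 0]
  · simp [brTerm, signedChoose_zero, Ring.lie_def]
  · intro j hj
    obtain ⟨k, rfl⟩ := Nat.exists_eq_succ_of_ne_zero hj
    simp [brTerm, signedChoose, Ring.choose_zero_succ]

theorem brMode_succ (n : ℤ) (a b : VertexOperator ℂ V) :
    brMode (n + 1) a b = shiftSub (1, 0) (0, 1) (brMode n a b) := by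
  funext x
  refine LinearMap.ext fun v => ?_
  obtain ⟨M, K⟩ := x
  obtain ⟨N, hN⟩ := exists_nat_mul_ncoeff_eq_zero a b (M, K) v
  let P (j : ℕ) : V := ncoeff a (M + n + 1 - j) (ncoeff b (K + j) v) +
    ((-1 : ℂ) ^ n) • ncoeff b (K + n + 1 - j) (ncoeff a (M + j) v)
  have hP : ∀ j ≥ N, P j = 0 := fun j hj => by
    obtain ⟨h1, h2⟩ := hN j hj
    simp only at h1 h2
    simp [P, h1, h2]
  rw [shiftSub_apply, LinearMap.sub_apply, brMode_apply, brMode_apply, brMode_apply,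
    ← finsum_sub_distrib (finite_support_brTerm _ _ _ _ _) (finite_support_brTerm _ _ _ _ _)]
  have h := finsum_signedChoose_succ n hP
  convert h using 1
  · refine finsum_congr fun j => ?_
    simp only [brTerm, P, LinearMap.smul_apply, LinearMap.sub_apply, Module.End.mul_apply,
      zpow_add_one₀ (neg_ne_zero.2 (one_ne_zero (α := ℂ)))]
    simp only [mul_neg, mul_one, neg_smul, sub_neg_eq_add, add_assoc]
  · refine finsum_congr fun j => ?_
    simp only [brTerm, P, LinearMap.smul_apply, LinearMap.sub_apply, Module.End.mul_apply,
      Prod.fst_add, Prod.snd_add, ← smul_sub, add_zero]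
    have e1 : M + 1 + n - j = M + n + 1 - j := by ring
    have e2 : K + 1 + n - j = K + n + 1 - j := by ring
    have e3 : M + n + 1 - ((j + 1 : ℕ) : ℤ) = M + n - j := by push_cast; ring
    have e4 : K + n + 1 - ((j + 1 : ℕ) : ℤ) = K + n - j := by push_cast; ring
    have e5 : M + 1 + j = M + ((j + 1 : ℕ) : ℤ) := by push_cast; ring
    have e6 : K + 1 + j = K + ((j + 1 : ℕ) : ℤ) := by push_cast; ring
    rw [e1, e2, e3, e4, e5, e6]
    congr 1
    abel

theorem brMode_add_nat (n : ℤ) (i : ℕ) (a b : VertexOperator ℂ V) :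
    brMode (n + i) a b = (shiftSub (1, 0) (0, 1) ^ i) (brMode n a b) := by
  induction i with
  | zero => simp
  | succ i ih =>
    rw [pow_succ', Module.End.mul_apply, ← ih, ← brMode_succ]
    congr 1
    push_cast
    ring

/-- For `n ≥ 0` the two expansions of `(z-w)ⁿ` coincide, so the bracket is `(z-w)ⁿ [a(z), b(w)]`. -/
theorem IsLocal.exists_brMode_eq_zero {a b : VertexOperator ℂ V} (h : IsLocal a b) :
    ∃ N : ℕ, ∀ n : ℤ, N ≤ n → brMode n a b = 0 := by
  obtain ⟨N, hN⟩ := h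
  refine ⟨N, fun n hn => ?_⟩
  obtain ⟨i, rfl⟩ := Int.le.dest hn
  have h1 := brMode_add_nat 0 N a b
  rw [show brMode 0 a b = fun x => ⁅ncoeff a x.1, ncoeff b x.2⁆ from
    funext (brMode_zero a b), hN, zero_add] at h1
  rw [brMode_add_nat, h1, map_zero]

/-- `(M, K, R) ↦ [f (M, K), c R]`. -/
def lieSlice (c : ℤ → Module.End ℂ V) :
    (ℤ × ℤ → Module.End ℂ V) →ₗ[ℂ] (ℤ × ℤ × ℤ → Module.End ℂ V) where
  toFun f x := ⁅f (x.1, x.2.1), c x.2.2⁆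
  map_add' f g := funext fun x => by
    simp only [Pi.add_apply, Ring.lie_def, add_mul, mul_add]
    abel
  map_smul' r f := funext fun x => by
    simp [Ring.lie_def, smul_sub]

/-- `(M, K, R) ↦ L M (f (K, R))`. -/
def liftSnd (L : ℤ → Module.End ℂ V →ₗ[ℂ] Module.End ℂ V) :
    (ℤ × ℤ → Module.End ℂ V) →ₗ[ℂ] (ℤ × ℤ × ℤ → Module.End ℂ V) where
  toFun f x := L x.1 (f x.2)
  map_add' f g := funext fun x => by simp
  map_smul' r f := funext fun x => by simp

/-- `(M, K, R) ↦ L K (f (M, R))`. -/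
def liftFst (L : ℤ → Module.End ℂ V →ₗ[ℂ] Module.End ℂ V) :
    (ℤ × ℤ → Module.End ℂ V) →ₗ[ℂ] (ℤ × ℤ × ℤ → Module.End ℂ V) where
  toFun f x := L x.2.1 (f (x.1, x.2.2))
  map_add' f g := funext fun x => by simp
  map_smul' r f := funext fun x => by simp

theorem shiftSub_lieSlice (c : ℤ → Module.End ℂ V) (f : ℤ × ℤ → Module.End ℂ V) :
    shiftSub (1, 0, 0) (0, 1, 0) (lieSlice c f) = lieSlice c (shiftSub (1, 0) (0, 1) f) := by
  funext x
  simp only [shiftSub_apply, lieSlice, LinearMap.coe_mk, AddHom.coe_mk, Ring.lie_def, sub_mul,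
    mul_sub, Prod.fst_add, Prod.snd_add, add_zero, Prod.mk_add_mk]
  abel

theorem shiftSub_liftSnd (L : ℤ → Module.End ℂ V →ₗ[ℂ] Module.End ℂ V)
    (f : ℤ × ℤ → Module.End ℂ V) :
    shiftSub (0, 1, 0) (0, 0, 1) (liftSnd L f) = liftSnd L (shiftSub (1, 0) (0, 1) f) := by
  funext x
  simp [shiftSub_apply, liftSnd]

theorem shiftSub_liftFst (L : ℤ → Module.End ℂ V →ₗ[ℂ] Module.End ℂ V)
    (f : ℤ × ℤ → Module.End ℂ V) :
    shiftSub (1, 0, 0) (0, 0, 1) (liftFst L f) = liftFst L (shiftSub (1, 0) (0, 1) f) := by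
  funext x
  simp [shiftSub_apply, liftFst]

/-- The operator `(z₁-z₃)ᴺ (z₂-z₃)ᴺ'` kills `L K (f (M, R)) + L' M (g (K, R))` if `f`, `g` are killed
by `(z-w)ᴺ`, `(z-w)ᴺ'`. -/
theorem shiftSub_pow_liftFst_add_liftSnd (L L' : ℤ → Module.End ℂ V →ₗ[ℂ] Module.End ℂ V)
    {f g : ℤ × ℤ → Module.End ℂ V} {N N' : ℕ} (hf : (shiftSub (1, 0) (0, 1) ^ N) f = 0)
    (hg : (shiftSub (1, 0) (0, 1) ^ N') g = 0) :
    (shiftSub (1, 0, 0) (0, 0, 1) ^ N) ((shiftSub (0, 1, 0) (0, 0, 1) ^ N')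
      (liftFst L f + liftSnd L' g)) = 0 := by
  rw [map_add, shiftSub_pow_comp (liftSnd L') (shiftSub_liftSnd L'), hg, map_zero, add_zero,
    ← Module.End.mul_apply, ((commute_shiftSub _ _ _ _).pow_pow _ _).eq, Module.End.mul_apply,
    shiftSub_pow_comp (liftFst L) (shiftSub_liftFst L), hf, map_zero, map_zero]

theorem isPointwiseSum_lieSlice (n : ℤ) (a b c : VertexOperator ℂ V) :
    IsPointwiseSum (fun j => lieSlice (ncoeff c) fun x => brTerm n a b x j)
      (lieSlice (ncoeff c) (brMode n a b)) := by
  intro x v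
  obtain ⟨M, K, R⟩ := x
  have h1 := finite_support_brTerm n a b (M, K) (ncoeff c R v)
  have h2 : (Function.support fun j => ncoeff c R (brTerm n a b (M, K) j v)).Finite :=
    (finite_support_brTerm n a b (M, K) v).subset fun j hj h => hj (by simp only [h, map_zero])
  constructor
  · exact (h1.union h2).subset (Function.support_sub _ _)
  · simp only [lieSlice, LinearMap.coe_mk, AddHom.coe_mk, Ring.lie_def, LinearMap.sub_apply,
      Module.End.mul_apply]
    rw [finsum_sub_distrib h1 h2, brMode_apply, brMode_apply]
    congr 1
    exact (ncoeff c R).toAddMonoidHom.map_finsum (finite_support_brTerm n a b (M, K) v)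

/-- By the Leibniz rule `[ab, c] = a [b, c] + [a, c] b`, each term contains a commutator with `c`
that one of the two powers kills; index shifts in `a` and `b` do not affect this. -/
theorem shiftSub_pow_lieSlice_brTerm (n : ℤ) {a b c : VertexOperator ℂ V} {N N' : ℕ}
    (hac : (shiftSub ((1, 0) : ℤ × ℤ) (0, 1) ^ N) (fun x => ⁅ncoeff a x.1, ncoeff c x.2⁆) = 0)
    (hbc : (shiftSub ((1, 0) : ℤ × ℤ) (0, 1) ^ N') (fun x => ⁅ncoeff b x.1, ncoeff c x.2⁆) = 0)
    (j : ℕ) :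
    (shiftSub (1, 0, 0) (0, 0, 1) ^ N) ((shiftSub (0, 1, 0) (0, 0, 1) ^ N')
      (lieSlice (ncoeff c) fun x => brTerm n a b x j)) = 0 := by
  have hshift {a : VertexOperator ℂ V} {N : ℕ} (s : ℤ)
      (h : (shiftSub ((1, 0) : ℤ × ℤ) (0, 1) ^ N) (fun x => ⁅ncoeff a x.1, ncoeff c x.2⁆) = 0) :
      (shiftSub ((1, 0) : ℤ × ℤ) (0, 1) ^ N)
        (fun x => ⁅ncoeff a (x.1 + s), ncoeff c x.2⁆) = 0 := by
    have h1 := shiftSub_pow_comp (g := ((1, 0) : ℤ × ℤ)) (h := (0, 1)) (g' := ((1, 0) : ℤ × ℤ))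
      (h' := (0, 1)) (LinearMap.funLeft ℂ (Module.End ℂ V) fun x : ℤ × ℤ => (x.1 + s, x.2))
      (fun f => by
        funext x
        simp [shiftSub_apply, LinearMap.funLeft_apply, add_right_comm]) N
      fun x => ⁅ncoeff a x.1, ncoeff c x.2⁆
    rw [h, map_zero] at h1
    exact h1
  have key : (lieSlice (ncoeff c) fun x => brTerm n a b x j) = signedChoose n j •
      ((liftFst (fun K => LinearMap.mulRight ℂ (ncoeff b (K + j)))
          (fun x => ⁅ncoeff a (x.1 + (n - j)), ncoeff c x.2⁆) +
        liftSnd (fun M => LinearMap.mulLeft ℂ (ncoeff a (M + n - j)))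
          (fun x => ⁅ncoeff b (x.1 + j), ncoeff c x.2⁆)) -
      ((-1 : ℂ) ^ n) •
      (liftFst (fun K => LinearMap.mulLeft ℂ (ncoeff b (K + n - j)))
          (fun x => ⁅ncoeff a (x.1 + j), ncoeff c x.2⁆) +
        liftSnd (fun M => LinearMap.mulRight ℂ (ncoeff a (M + j)))
          (fun x => ⁅ncoeff b (x.1 + (n - j)), ncoeff c x.2⁆))) := by
    funext x
    obtain ⟨M, K, R⟩ := x
    simp only [lieSlice, liftFst, liftSnd, LinearMap.coe_mk, AddHom.coe_mk, brTerm, Pi.smul_apply,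
      Pi.add_apply, Pi.sub_apply, LinearMap.mulLeft_apply, LinearMap.mulRight_apply, Ring.lie_def,
      smul_mul_assoc, mul_smul_comm, ← smul_sub, sub_mul, mul_sub, mul_assoc, add_sub_assoc]
    congr 1
    simp only [smul_sub, smul_add]
    abel
  rw [key]
  simp only [map_smul, map_sub, shiftSub_pow_liftFst_add_liftSnd _ _ (hshift _ hac) (hshift _ hbc),
    smul_zero, sub_zero]

/-- Dong's lemma. -/
theorem IsLocal.circ {a b c : VertexOperator ℂ V} (hab : IsLocal a b) (hac : IsLocal a c)
    (hbc : IsLocal b c) (n : ℤ) : IsLocal (circ n a b) c := by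
  obtain ⟨N, hN⟩ := hab.exists_brMode_eq_zero
  obtain ⟨N₁, h1⟩ := hac
  obtain ⟨N₂, h2⟩ := hbc
  let H := lieSlice (ncoeff c) (brMode n a b)
  -- With variables `z₁, z₂, z₃` for `a, b, c`: after multiplication by `(z₂-z₃)^N₂`, powers of both
  -- `z₁-z₃` and `z₁-z₂` kill `H`. Hence so does a power of their difference `z₂-z₃`, and the
  -- residue in `z₁` gives the claim.
  have hx : (shiftSub (1, 0, 0) (0, 0, 1) ^ N₁) ((shiftSub (0, 1, 0) (0, 0, 1) ^ N₂) H) = 0 :=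
    (((isPointwiseSum_lieSlice n a b c).shiftSub_pow _ _ N₂).shiftSub_pow _ _ N₁).eq_zero
      (shiftSub_pow_lieSlice_brTerm n h1 h2)
  have hy : (shiftSub (1, 0, 0) (0, 1, 0) ^ (N - n).toNat)
      ((shiftSub (0, 1, 0) (0, 0, 1) ^ N₂) H) = 0 := by
    rw [← Module.End.mul_apply, ((commute_shiftSub _ _ _ _).pow_pow _ _).eq, Module.End.mul_apply,
      shiftSub_pow_comp (lieSlice (ncoeff c)) (shiftSub_lieSlice _), ← brMode_add_nat,
      hN _ (by omega), map_zero, map_zero]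
  have hz := sub_pow_apply_eq_zero (commute_shiftSub _ _ _ _) hx hy
  rw [shiftSub_sub_shiftSub, ← Module.End.mul_apply, ← pow_add] at hz
  refine ⟨N₁ + (N - n).toNat + N₂, ?_⟩
  have h3 := shiftSub_pow_comp (g := ((0, 1, 0) : ℤ × ℤ × ℤ)) (h := (0, 0, 1))
    (g' := ((1, 0) : ℤ × ℤ)) (h' := (0, 1))
    (LinearMap.funLeft ℂ (Module.End ℂ V) fun x : ℤ × ℤ => ((0, x) : ℤ × ℤ × ℤ))
    (fun f => by
      funext x
      simp [shiftSub_apply, LinearMap.funLeft_apply]) (N₁ + (N - n).toNat + N₂) H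
  rw [hz, map_zero] at h3
  rw [← h3]
  congr 1
  funext x
  simp only [LinearMap.funLeft_apply, H, lieSlice, LinearMap.coe_mk, AddHom.coe_mk,
    brMode_eq_ncoeff_circ]

end QOA

namespace QOA

open VertexOperator

variable {V : Type*} [AddCommGroup V] [Module ℂ V]

/-! ### Closures and words -/

theorem mem_closure {S : Set (VertexOperator ℂ V)} {a : VertexOperator ℂ V} :
    a ∈ closure S ↔ ∀ A : Algebra V, S ⊆ A.carrier → a ∈ A := by
  refine Submodule.mem_sInf.trans ⟨fun h A hA => h _ ⟨A, hA, rfl⟩, ?_⟩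
  rintro h _ ⟨A, hA, rfl⟩
  exact h A hA

theorem subset_closure (S : Set (VertexOperator ℂ V)) : S ⊆ (closure S).carrier :=
  fun _ ha => mem_closure.2 fun _ hA => hA ha

theorem circTerm_eq (n : ℤ) (a b : VertexOperator ℂ V) (m : ℤ) (j : ℕ) (v : V) :
    circTerm n a b m j v = signedChoose n j • (ncoeff a (n - j) (ncoeff b (m + j) v) -
      ((-1 : ℂ) ^ n) • ncoeff b (m + n - j) (ncoeff a j v)) := rfl

theorem circ_add_left (n : ℤ) (a a' b : VertexOperator ℂ V) :
    circ n (a + a') b = circ n a b + circ n a' b := by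
  refine ext_modes fun m => LinearMap.ext fun v => ?_
  rw [map_add, Pi.add_apply, LinearMap.add_apply, ncoeff_circ, ncoeff_circ, ncoeff_circ,
    ← finsum_add_distrib (finite_support_circTerm n a b m v) (finite_support_circTerm n a' b m v)]
  refine finsum_congr fun j => ?_
  simp only [circTerm_eq, map_add, Pi.add_apply, LinearMap.add_apply, ← smul_add]
  congr 1
  rw [smul_add]
  abel

theorem circ_add_right (n : ℤ) (a b b' : VertexOperator ℂ V) :
    circ n a (b + b') = circ n a b + circ n a b' := by
  refine ext_modes fun m => LinearMap.ext fun v => ?_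
  rw [map_add, Pi.add_apply, LinearMap.add_apply, ncoeff_circ, ncoeff_circ, ncoeff_circ,
    ← finsum_add_distrib (finite_support_circTerm n a b m v) (finite_support_circTerm n a b' m v)]
  refine finsum_congr fun j => ?_
  simp only [circTerm_eq, map_add, Pi.add_apply, LinearMap.add_apply, ← smul_add]
  congr 1
  rw [smul_add]
  abel

theorem circ_smul_left (n : ℤ) (c : ℂ) (a b : VertexOperator ℂ V) :
    circ n (c • a) b = c • circ n a b := by
  refine ext_modes fun m => LinearMap.ext fun v => ?_
  rw [map_smul, Pi.smul_apply, LinearMap.smul_apply, ncoeff_circ, ncoeff_circ, smul_finsum]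
  refine finsum_congr fun j => ?_
  simp only [circTerm_eq, map_smul, Pi.smul_apply, LinearMap.smul_apply]
  module

theorem circ_smul_right (n : ℤ) (c : ℂ) (a b : VertexOperator ℂ V) :
    circ n a (c • b) = c • circ n a b := by
  refine ext_modes fun m => LinearMap.ext fun v => ?_
  rw [map_smul, Pi.smul_apply, LinearMap.smul_apply, ncoeff_circ, ncoeff_circ, smul_finsum]
  refine finsum_congr fun j => ?_
  simp only [circTerm_eq, map_smul, Pi.smul_apply, LinearMap.smul_apply]
  module

/-- The circle product as a bilinear map. -/
noncomputable def circHom (n : ℤ) :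
    VertexOperator ℂ V →ₗ[ℂ] VertexOperator ℂ V →ₗ[ℂ] VertexOperator ℂ V :=
  LinearMap.mk₂ ℂ (circ n) (circ_add_left n) (fun c a b => circ_smul_left n c a b)
    (circ_add_right n) (fun c a b => circ_smul_right n c a b)

theorem circHom_apply (n : ℤ) (a b : VertexOperator ℂ V) : circHom n a b = circ n a b := rfl

theorem circ_mem_span_isWord {S : Set (VertexOperator ℂ V)} (n : ℤ) {a b : VertexOperator ℂ V}
    (ha : a ∈ Submodule.span ℂ {w | IsWord S w}) (hb : b ∈ Submodule.span ℂ {w | IsWord S w}) :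
    circ n a b ∈ Submodule.span ℂ {w | IsWord S w} := by
  have h := Submodule.apply_mem_map₂ (circHom n) ha hb
  rw [Submodule.map₂_span_span] at h
  refine Submodule.span_mono ?_ h
  rintro _ ⟨x, hx, y, hy, rfl⟩
  exact IsWord.circ n hx hy

/-- The identity field has one nonzero mode, so a single term survives: from `a b` if `m < 0`, from
`b a` if `m > 0`. The coefficients of `(z-w)⁻²` are `j + 1`. -/
theorem derivative_eq_circ (a : VertexOperator ℂ V) : derivative a = circ (-2) a one := by
  refine ext_modes fun m => LinearMap.ext fun v => ?_
  have he : ∀ j : ℕ, signedChoose (-2) j = j + 1 := by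
    intro j
    induction j with
    | zero => simp [signedChoose_zero]
    | succ j ih =>
      have h := signedChoose_succ_mul (-2) j
      rw [ih] at h
      have h1 : (j : ℂ) + 1 ≠ 0 := by exact_mod_cast j.succ_ne_zero
      apply mul_right_cancel₀ h1
      rw [h]
      push_cast
      ring
  rw [derivative, ncoeff_ofModes, ncoeff_circ]
  simp only [circTerm_eq, one, ncoeff_ofModes, he]
  rcases lt_or_ge m 0 with hm | hm
  · obtain ⟨k, rfl⟩ : ∃ k : ℕ, m = -1 - k := ⟨(-1 - m).toNat, by omega⟩
    rw [finsum_eq_single _ k]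
    · rw [if_pos (by ring), if_neg (by omega)]
      simp only [LinearMap.smul_apply, Module.End.one_apply, LinearMap.zero_apply, smul_zero, sub_zero]
      rw [show (-1 - k - 1 : ℤ) = -2 - k by ring]
      congr 1
      push_cast
      ring
    · intro j hj
      rw [if_neg (by omega), if_neg (by omega)]
      simp
  · obtain ⟨k, rfl⟩ := Int.eq_ofNat_of_zero_le hm
    rcases Nat.eq_zero_or_pos k with rfl | hk
    · rw [finsum_eq_zero_of_forall_eq_zero]
      · simp
      · intro j
        rw [if_neg (by omega), if_neg (by omega)]
        simp
    obtain ⟨k, rfl⟩ := Nat.exists_eq_succ_of_ne_zero hk.ne'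
    rw [finsum_eq_single _ k]
    · rw [if_neg (by omega), if_pos (by push_cast; ring)]
      simp only [LinearMap.smul_apply, Module.End.one_apply, LinearMap.zero_apply, map_zero, zero_sub,
        Nat.succ_eq_add_one]
      rw [show ((-1 : ℂ) ^ (-2 : ℤ)) = 1 by norm_num, one_smul, smul_neg, ← neg_smul]
      rw [show (((k + 1 : ℕ) : ℤ) - 1) = k by push_cast; ring]
      congr 1
      push_cast
      ring
    · intro j hj
      rw [if_neg (by omega), if_neg (by omega)]
      simp

theorem Algebra.one_mem (A : Algebra V) : one ∈ A := A.one_mem'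

theorem Algebra.circ_mem (A : Algebra V) (n : ℤ) {a b : VertexOperator ℂ V} (ha : a ∈ A)
    (hb : b ∈ A) : circ n a b ∈ A := A.circ_mem' n ha hb

theorem Algebra.derivative_mem (A : Algebra V) {a : VertexOperator ℂ V} (ha : a ∈ A) :
    derivative a ∈ A := by
  rw [derivative_eq_circ]
  exact A.circ_mem _ ha A.one_mem

theorem Algebra.derivative_iterate_mem (A : Algebra V) {a : VertexOperator ℂ V} (ha : a ∈ A)
    (k : ℕ) : derivative^[k] a ∈ A := by
  induction k with
  | zero => exact ha
  | succ k ih => rw [Function.iterate_succ_apply']; exact A.derivative_mem ih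

/-- The fields in the closure of a set of mutually local fields are mutually local. -/
theorem isLocal_of_mem_closure {S : Set (VertexOperator ℂ V)}
    (hS : ∀ a ∈ S, ∀ b ∈ S, IsLocal a b) {a b : VertexOperator ℂ V} (ha : a ∈ closure S)
    (hb : b ∈ closure S) : IsLocal a b := by
  -- A maximal mutually local family absorbs every field local to itself and to the family; by
  -- Dong's lemma it is then an algebra, so it contains the closure.
  obtain ⟨M, hSM, hM⟩ := zorn_subset_nonempty
    {M : Set (VertexOperator ℂ V) | ∀ a ∈ M, ∀ b ∈ M, IsLocal a b}
    (fun c hc hchain _ => ⟨⋃₀ c, by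
      rintro a ⟨s, hs, has⟩ b ⟨t, ht, hbt⟩
      rcases hchain.total hs ht with hst | hst
      · exact hc ht a (hst has) b hbt
      · exact hc hs a has b (hst hbt), fun s hs => Set.subset_sUnion_of_mem hs⟩) S hS
  have hmem : ∀ {d : VertexOperator ℂ V}, (∀ x ∈ M, IsLocal d x) → IsLocal d d → d ∈ M := by
    intro d hd hdd
    have h := hM.le_of_ge (y := insert d M) (by
      rintro x (rfl | hx) y (rfl | hy)
      · exact hdd
      · exact hd y hy
      · exact (hd x hx).symm
      · exact hM.prop x hx y hy) (Set.subset_insert d M)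
    exact h (Set.mem_insert d M)
  let A : Algebra V :=
    { carrier := M
      zero_mem' := hmem (fun x _ => isLocal_zero x) (isLocal_zero _)
      add_mem' := fun {a b} ha hb => by
        have h : ∀ x ∈ M, IsLocal (a + b) x := fun x hx =>
          (hM.prop a ha x hx).add (hM.prop b hb x hx)
        exact hmem h ((h a ha).symm.add (h b hb).symm)
      smul_mem' := fun c {a} ha => by
        have h : ∀ x ∈ M, IsLocal (c • a) x := fun x hx => (hM.prop a ha x hx).smul c
        exact hmem h ((h a ha).symm.smul c)
      one_mem' := hmem (fun x _ => isLocal_one x) (isLocal_one _)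
      circ_mem' := fun n {a b} ha hb => by
        have h : ∀ x ∈ M, IsLocal (circ n a b) x := fun x hx =>
          (hM.prop a ha b hb).circ (hM.prop a ha x hx) (hM.prop b hb x hx) n
        exact hmem h ((hM.prop a ha b hb).circ (h a ha).symm (h b hb).symm n) }
  exact hM.prop a (mem_closure.1 ha A hSM) b (mem_closure.1 hb A hSM)

/-! ### Vacuum and translation -/

section Translation

variable {T : Module.End ℂ V} {Ω : V}

/-- The field `a` creates a state from the vacuum `Ω`, and `[T, a(z)] = ∂ a(z)`. -/
structure IsCovariant (T : Module.End ℂ V) (Ω : V) (a : VertexOperator ℂ V) : Prop where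
  vacuum : ∀ m : ℤ, 0 ≤ m → ncoeff a m Ω = 0
  translation : ∀ m v, T (ncoeff a m v) = ncoeff a m (T v) - (m : ℂ) • ncoeff a (m - 1) v

theorem IsCovariant.circ {a b : VertexOperator ℂ V} (ha : IsCovariant T Ω a)
    (hb : IsCovariant T Ω b) (n : ℤ) : IsCovariant T Ω (circ n a b) where
  vacuum m hm := by
    rw [ncoeff_circ]
    refine finsum_eq_zero_of_forall_eq_zero fun j => ?_
    rw [circTerm_eq, hb.vacuum _ (by omega), ha.vacuum _ (by omega)]
    simp
  translation m v := by
    -- Commuting `T` through a term leaves the expected `-m` contribution and the extra terms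
    -- `-((n-j) P(j+1) + j P(j))`, whose weighted sum telescopes to zero.
    let P (j : ℕ) : V := ncoeff a (n - j) (ncoeff b (m - 1 + j) v) -
      ((-1 : ℂ) ^ n) • ncoeff b (m + n - j) (ncoeff a (-1 + j) v)
    obtain ⟨N, hN⟩ := exists_nat_mul_ncoeff_eq_zero a b (-1, m - 1) v
    have hP : ∀ j ≥ N, P j = 0 := fun j hj => by
      obtain ⟨h1, h2⟩ := hN j hj
      simp only at h1 h2
      simp [P, h1, h2]
    have hfin : (Function.support fun j : ℕ =>
        signedChoose n j • (((n : ℂ) - j) • P (j + 1) + (j : ℂ) • P j)).Finite := by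
      refine (Set.finite_lt_nat N).subset fun j hj => ?_
      by_contra hlt
      rw [Set.mem_ofPred_eq, not_lt] at hlt
      exact hj (by simp [hP j hlt, hP (j + 1) (by omega)])
    have h0 := finsum_signedChoose_mul n hP
    have hfin2 : (Function.support fun j : ℕ => (m : ℂ) • circTerm n a b (m - 1) j v).Finite :=
      (finite_support_circTerm n a b (m - 1) v).subset fun j hj h => hj (by simp only [h, smul_zero])
    have hT : T (∑ᶠ j, circTerm n a b m j v) = ∑ᶠ j, T (circTerm n a b m j v) :=
      T.toAddMonoidHom.map_finsum (finite_support_circTerm n a b m v)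
    rw [ncoeff_circ, ncoeff_circ, ncoeff_circ, hT, smul_finsum, ← sub_zero (_ - _), ← h0,
      ← finsum_sub_distrib (finite_support_circTerm _ _ _ _ _) hfin2,
      ← finsum_sub_distrib (((finite_support_circTerm _ _ _ _ _).union hfin2).subset
        (Function.support_sub _ _)) hfin]
    refine finsum_congr fun j => ?_
    have e1 : n - ((j + 1 : ℕ) : ℤ) = n - j - 1 := by push_cast; ring
    have e2 : m - 1 + ((j + 1 : ℕ) : ℤ) = m + j := by push_cast; ring
    have e3 : m + n - ((j + 1 : ℕ) : ℤ) = m + n - j - 1 := by push_cast; ring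
    have e4 : -1 + ((j + 1 : ℕ) : ℤ) = j := by push_cast; ring
    have e5 : m + j - 1 = m - 1 + (j : ℤ) := by ring
    have e6 : (j : ℤ) - 1 = -1 + j := by ring
    have e7 : m - 1 + n - (j : ℤ) = m + n - j - 1 := by ring
    simp only [circTerm_eq, P, map_smul, map_sub, ha.translation, hb.translation, e1, e2, e3, e4, e5,
      e6, e7]
    push_cast
    module

/-- All `a(j) Ω` with `j ≥ 0` and all `b(-1+j) Ω` with `j ≥ 1` vanish, so only the leading term
remains. -/
theorem ncoeff_circ_vacuum (n : ℤ) {a b : VertexOperator ℂ V} (ha : IsCovariant T Ω a)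
    (hb : IsCovariant T Ω b) : ncoeff (circ n a b) (-1) Ω = ncoeff a n (ncoeff b (-1) Ω) := by
  rw [ncoeff_circ, finsum_eq_single _ 0]
  · rw [circTerm_eq, ha.vacuum _ (by simp)]
    simp [signedChoose_zero]
  · intro j hj
    rw [circTerm_eq, ha.vacuum _ (by simp), hb.vacuum _ (by omega)]
    simp

/-- The covariant fields. -/
def covariantFields (T : Module.End ℂ V) (Ω : V) : Algebra V where
  carrier := {a | IsCovariant T Ω a}
  zero_mem' := ⟨fun m _ => by simp, fun m v => by simp⟩
  add_mem' ha hb := ⟨fun m hm => by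
    simp [ha.vacuum m hm, hb.vacuum m hm], fun m v => by
    simp only [map_add, Pi.add_apply, LinearMap.add_apply, ha.translation, hb.translation, smul_add]
    abel⟩
  smul_mem' c a ha := ⟨fun m hm => by simp [ha.vacuum m hm], fun m v => by
    simp only [map_smul, Pi.smul_apply, LinearMap.smul_apply, ha.translation, smul_sub, smul_comm c]⟩
  one_mem' := ⟨fun m hm => by
    rw [one, ncoeff_ofModes, if_neg (by omega), LinearMap.zero_apply], fun m v => by
    simp only [one, ncoeff_ofModes]
    by_cases h0 : m = 0
    · simp [h0]
    · rw [if_neg (show m - 1 ≠ -1 by omega)]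
      split_ifs <;> simp⟩
  circ_mem' n _ _ ha hb := ha.circ hb n

/-- Covariance gives `T a(m) Ω = -m a(m-1) Ω`, so vanishing at `-1` propagates to all lower modes.
-/
theorem IsCovariant.ncoeff_vacuum_eq_zero {a : VertexOperator ℂ V} (ha : IsCovariant T Ω a)
    (hT : T Ω = 0) (h : ncoeff a (-1) Ω = 0) (m : ℤ) : ncoeff a m Ω = 0 := by
  rcases le_or_gt 0 m with hm | hm
  · exact ha.vacuum m hm
  obtain ⟨k, rfl⟩ : ∃ k : ℕ, m = -1 - k := ⟨(-1 - m).toNat, by omega⟩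
  clear hm
  induction k with
  | zero => simpa using h
  | succ k ih =>
    have h1 := ha.translation (-1 - k) Ω
    rw [ih, hT, map_zero, map_zero, zero_sub, eq_comm, neg_eq_zero, smul_eq_zero] at h1
    have h2 : ((-1 - k : ℤ) : ℂ) ≠ 0 := by
      rw [Int.cast_ne_zero]
      omega
    have h3 := h1.resolve_left h2
    rwa [show (-1 - ((k + 1 : ℕ) : ℤ)) = -1 - k - 1 by push_cast; ring]

end Translation

end QOA

namespace Heisenberg

open VertexOperator QOA MvPolynomial

variable {n : ℕ}

/-! ### The Heisenberg fields -/

theorem ncoeff_alpha (i : Fin n) (m : ℤ) : ncoeff (alpha i) m = mode i m := ncoeff_ofModes _ _ m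

theorem mode_zero (i : Fin n) : mode i 0 = 0 := rfl

theorem mode_neg (i : Fin n) (k : ℕ) (p : Fock n) : mode i (-1 - k) p = X (i, k) * p := by
  rw [show (-1 - k : ℤ) = Int.negSucc k by rw [Int.negSucc_eq]; ring]
  rfl

theorem mode_pos (i : Fin n) (k : ℕ) (p : Fock n) :
    mode i (k + 1) p = ((k : ℂ) + 1) • pderiv (i, k) p := rfl

theorem mode_cases {P : ℤ → Prop} (m : ℤ) (h0 : P 0) (hpos : ∀ k : ℕ, P (k + 1))
    (hneg : ∀ k : ℕ, P (-1 - k)) : P m := by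
  rcases lt_trichotomy m 0 with h | rfl | h
  · obtain ⟨k, rfl⟩ : ∃ k : ℕ, m = -1 - k := ⟨(-1 - m).toNat, by omega⟩
    exact hneg k
  · exact h0
  · obtain ⟨k, rfl⟩ : ∃ k : ℕ, m = k + 1 := ⟨(m - 1).toNat, by omega⟩
    exact hpos k

theorem lie_mode (i l : Fin n) (m k : ℤ) :
    ⁅mode i m, mode l k⁆ = if i = l ∧ m + k = 0 then (m : ℂ) • (1 : Module.End ℂ (Fock n)) else 0 := by
  classical
  refine LinearMap.ext fun p => ?_
  rw [Ring.lie_def, LinearMap.sub_apply, Module.End.mul_apply, Module.End.mul_apply]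
  induction m using mode_cases with
  | h0 => simp [mode_zero]
  | hpos m =>
    induction k using mode_cases with
    | h0 =>
      rw [if_neg (by omega)]
      simp [mode_zero]
    | hpos k =>
      rw [if_neg (by omega)]
      simp only [mode_pos, map_smul, LinearMap.zero_apply]
      rw [pderiv_comm, smul_comm, sub_self]
    | hneg k =>
      simp only [mode_pos, mode_neg, Derivation.leibniz, pderiv_X, Pi.single_apply, smul_eq_mul,
        Prod.mk.injEq, mul_smul_comm, smul_add]
      rw [add_sub_cancel_left]
      by_cases h : l = i ∧ k = m
      · obtain ⟨rfl, rfl⟩ := h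
        rw [if_pos ⟨rfl, rfl⟩, if_pos ⟨rfl, by ring⟩]
        simp
      · rw [if_neg h, if_neg (by
          rintro ⟨rfl, h1⟩
          exact h ⟨rfl, by omega⟩)]
        simp
  | hneg m =>
    induction k using mode_cases with
    | h0 =>
      rw [if_neg (by omega)]
      simp [mode_zero]
    | hpos k =>
      simp only [mode_pos, mode_neg, Derivation.leibniz, pderiv_X, Pi.single_apply, smul_eq_mul,
        Prod.mk.injEq, mul_smul_comm, smul_add]
      rw [sub_add_cancel_left]
      by_cases h : i = l ∧ m = k
      · obtain ⟨rfl, rfl⟩ := h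
        rw [if_pos ⟨rfl, rfl⟩, if_pos ⟨rfl, by ring⟩]
        simp only [LinearMap.smul_apply, Module.End.one_apply, mul_one, ← neg_smul]
        congr 1
        push_cast
        ring
      · rw [if_neg h, if_neg (by
          rintro ⟨rfl, h1⟩
          exact h ⟨rfl, by omega⟩)]
        simp
    | hneg k =>
      rw [if_neg (by omega), mode_neg, mode_neg, mode_neg, mode_neg, mul_left_comm, sub_self,
        LinearMap.zero_apply]

theorem isLocal_alpha (i l : Fin n) : IsLocal (alpha i) (alpha l) := by
  -- The commutator is linear in the first index along the antidiagonal where it lives, so its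
  -- second difference vanishes.
  refine ⟨2, ?_⟩
  rw [pow_two, Module.End.mul_apply]
  funext x
  obtain ⟨M, K⟩ := x
  simp only [shiftSub_apply, ncoeff_alpha, lie_mode, Pi.zero_apply, Prod.mk_add_mk, add_zero,
    show ∀ a b : ℤ, a + (b + 1) = a + b + 1 from fun a b => by ring,
    show ∀ a b : ℤ, a + 1 + b = a + b + 1 from fun a b => by ring]
  by_cases h : i = l ∧ M + K + 1 + 1 = 0
  · simp only [if_pos h]
    push_cast
    module
  · simp [if_neg h]

/-- The translation operator, the derivation `X (i, k) ↦ (k + 1) X (i, k + 1)`. -/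
noncomputable def translation (n : ℕ) : Derivation ℂ (Fock n) (Fock n) :=
  mkDerivation ℂ fun x => ((x.2 : ℂ) + 1) • X (x.1, x.2 + 1)

theorem translation_X (i : Fin n) (k : ℕ) :
    translation n (X (i, k)) = ((k : ℂ) + 1) • X (i, k + 1) := mkDerivation_X _ _ _

theorem pderiv_translation (i : Fin n) (k : ℕ) (p : Fock n) :
    pderiv (i, k + 1) (translation n p) =
      translation n (pderiv (i, k + 1) p) + ((k : ℂ) + 1) • pderiv (i, k) p := by
  classical
  have h : ⁅pderiv (R := ℂ) (i, k + 1), translation n⁆ = ((k : ℂ) + 1) • pderiv (i, k) := by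
    refine derivation_ext fun ⟨l, r⟩ => ?_
    simp only [Derivation.commutator_apply, translation_X, Derivation.map_smul, pderiv_X, Pi.single_apply,
      Prod.mk.injEq, Derivation.smul_apply, add_left_inj]
    by_cases h1 : l = i ∧ r = k
    · obtain ⟨rfl, rfl⟩ := h1
      simp
    · rw [if_neg h1]
      split_ifs <;> simp
  have := DFunLike.congr_fun h p
  rw [Derivation.commutator_apply, Derivation.smul_apply, sub_eq_iff_eq_add'] at this
  exact this

theorem pderiv_zero_translation (i : Fin n) (p : Fock n) :
    pderiv (i, 0) (translation n p) = translation n (pderiv (i, 0) p) := by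
  classical
  have h : ⁅pderiv (R := ℂ) (i, 0), translation n⁆ = 0 := by
    refine derivation_ext fun ⟨l, r⟩ => ?_
    simp only [Derivation.commutator_apply, translation_X, Derivation.map_smul, pderiv_X, Pi.single_apply,
      Prod.mk.injEq, Derivation.zero_apply]
    split_ifs <;> simp_all
  have := DFunLike.congr_fun h p
  rwa [Derivation.commutator_apply, Derivation.zero_apply, sub_eq_zero] at this

theorem isCovariant_alpha (i : Fin n) :
    IsCovariant (translation n).toLinearMap (1 : Fock n) (alpha i) where
  vacuum m hm := by
    rw [ncoeff_alpha]
    induction m using mode_cases with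
    | h0 => simp [mode_zero]
    | hpos k => simp [mode_pos]
    | hneg k => omega
  translation m p := by
    simp only [ncoeff_alpha, Derivation.coeFn_coe]
    induction m using mode_cases with
    | h0 => simp [mode_zero]
    | hpos k =>
      rw [add_sub_cancel_right, mode_pos, mode_pos, Derivation.map_smul]
      rcases k with _ | k
      · simp [mode_zero, pderiv_zero_translation]
      · rw [pderiv_translation, show ((k + 1 : ℕ) : ℤ) = (k : ℤ) + 1 from Nat.cast_succ k, mode_pos]
        push_cast
        module
    | hneg k =>
      rw [show (-1 - k - 1 : ℤ) = -1 - ((k + 1 : ℕ) : ℤ) by push_cast; ring, mode_neg, mode_neg,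
        mode_neg, Derivation.leibniz, translation_X]
      simp only [smul_eq_mul, mul_smul_comm]
      rw [mul_comm p]
      push_cast
      module

theorem isCovariant_of_mem {a : VertexOperator ℂ (Fock n)} (ha : a ∈ algebra n) :
    IsCovariant (translation n).toLinearMap (1 : Fock n) a :=
  mem_closure.1 ha (covariantFields _ _) (by
    rintro _ ⟨i, rfl⟩
    exact isCovariant_alpha i)

theorem alpha_mem (i : Fin n) : alpha i ∈ algebra n := subset_closure _ ⟨i, rfl⟩

theorem isLocal_of_mem {a b : VertexOperator ℂ (Fock n)} (ha : a ∈ algebra n)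
    (hb : b ∈ algebra n) : IsLocal a b :=
  isLocal_of_mem_closure (by
    rintro _ ⟨i, rfl⟩ _ ⟨l, rfl⟩
    exact isLocal_alpha i l) ha hb

/-! ### Fields are determined by their states. -/

/-- A function killed by the difference operator is constant along antidiagonals, and each
antidiagonal meets the region where it vanishes; powers follow by induction. -/
theorem eq_zero_of_shiftSub_pow {W : Type*} [AddCommGroup W] [Module ℂ W] {u : ℤ × ℤ → W} {N : ℕ}
    (hN : (shiftSub (1, 0) (0, 1) ^ N) u = 0) {M₀ : ℤ} (h : ∀ M ≥ M₀, ∀ K, u (M, K) = 0) : u = 0 := by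
  induction N generalizing u M₀ with
  | zero => simpa using hN
  | succ N ih =>
    rw [pow_succ, Module.End.mul_apply] at hN
    have h1 := ih hN (M₀ := M₀) fun M hM K => by
      rw [shiftSub_apply, Prod.mk_add_mk, Prod.mk_add_mk, h _ (by omega), h _ (by omega), sub_zero]
    have h2 : ∀ M K, u (M + 1, K) = u (M, K + 1) := fun M K => by
      have := congrFun h1 (M, K)
      simpa [shiftSub_apply, sub_eq_zero] using this
    have h3 : ∀ k : ℕ, ∀ K, u (M₀ - k, K) = 0 := by
      intro k
      induction k with
      | zero => exact fun K => h _ (by simp) K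
      | succ k ihk =>
        intro K
        have h4 := h2 (M₀ - (k + 1 : ℕ)) (K - 1)
        rw [sub_add_cancel, show M₀ - ((k + 1 : ℕ) : ℤ) + 1 = M₀ - k by push_cast; ring, ihk] at h4
        exact h4.symm
    funext ⟨M, K⟩
    rcases le_or_gt M₀ M with hM | hM
    · exact h M hM K
    · have := h3 (M₀ - M).toNat K
      rwa [Int.toNat_of_nonneg (by omega), sub_sub_cancel] at this

/-- A field of the Heisenberg algebra is determined by its state. -/
theorem eq_zero_of_state_eq_zero {a : VertexOperator ℂ (Fock n)} (ha : a ∈ algebra n)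
    (h : ncoeff a (-1) 1 = 0) : a = 0 := by
  have h1 := (isCovariant_of_mem ha).ncoeff_vacuum_eq_zero (by simp) h
  suffices H : ∀ (p : Fock n) (m : ℤ), ncoeff a m p = 0 from
    ext_modes fun m => LinearMap.ext fun p => by simp [H p m]
  intro p
  induction p using MvPolynomial.induction_on with
  | C c =>
    intro m
    rw [← mul_one (C c), C_mul', map_smul, h1, smul_zero]
  | add p q hp hq =>
    intro m
    rw [map_add, hp, hq, add_zero]
  | mul_X p x hp =>
    obtain ⟨i, k⟩ := x
    intro m
    obtain ⟨N, hN⟩ := isLocal_of_mem (alpha_mem i) ha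
    let Λ : (ℤ × ℤ → Module.End ℂ (Fock n)) →ₗ[ℂ] (ℤ × ℤ → Fock n) :=
      { toFun := fun f x => f x p
        map_add' := fun _ _ => rfl
        map_smul' := fun _ _ => rfl }
    have h2 := shiftSub_pow_comp (g := ((1, 0) : ℤ × ℤ)) (h := (0, 1)) (g' := ((1, 0) : ℤ × ℤ))
      (h' := (0, 1)) Λ (fun f => rfl) N fun x => ⁅ncoeff (alpha i) x.1, ncoeff a x.2⁆
    rw [hN, map_zero] at h2
    obtain ⟨M₀, hM₀⟩ := exists_ncoeff_eq_zero (alpha i) p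
    -- All modes of `a` kill `p`, so the commutator on `p` is `-a(K) αⁱ(M) p`, zero for large `M`.
    -- By locality it vanishes for every `M`, and `M = -1-k` is multiplication by `X (i, k)`.
    have h3 := eq_zero_of_shiftSub_pow h2 (M₀ := M₀) fun M hM K => by
      simp [Λ, Ring.lie_def, hp, hM₀ M hM]
    have h4 := congrFun h3 (-1 - k, m)
    simp only [Λ, LinearMap.coe_mk, AddHom.coe_mk, Ring.lie_def, LinearMap.sub_apply,
      Module.End.mul_apply, hp, map_zero, zero_sub, Pi.zero_apply, neg_eq_zero, ncoeff_alpha,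
      mode_neg] at h4
    rwa [mul_comm]

theorem eq_of_state_eq {a b : VertexOperator ℂ (Fock n)} (ha : a ∈ algebra n) (hb : b ∈ algebra n)
    (h : ncoeff a (-1) 1 = ncoeff b (-1) 1) : a = b := by
  have h1 : a - b ∈ algebra n := (algebra n).toSubmodule.sub_mem ha hb
  refine sub_eq_zero.1 (eq_zero_of_state_eq_zero h1 ?_)
  rw [map_sub, Pi.sub_apply, LinearMap.sub_apply, h, sub_self]

end Heisenberg

namespace Heisenberg

open VertexOperator QOA MvPolynomial

variable {n : ℕ}

/-! ### Modes of the quadratic fields -/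

theorem ncoeff_derivative {V : Type*} [AddCommGroup V] [Module ℂ V] (a : VertexOperator ℂ V)
    (m : ℤ) : ncoeff (derivative a) m = (-(m : ℂ)) • ncoeff a (m - 1) := ncoeff_ofModes _ _ m

theorem ncoeff_derivative_iterate {V : Type*} [AddCommGroup V] [Module ℂ V]
    (a : VertexOperator ℂ V) (k : ℕ) (m : ℤ) :
    ncoeff (derivative^[k] a) m = (∏ r ∈ Finset.range k, ((r : ℂ) - m)) • ncoeff a (m - k) := by
  induction k generalizing m with
  | zero => simp
  | succ k ih =>
    rw [Function.iterate_succ_apply', ncoeff_derivative, ih, smul_smul, Finset.prod_range_succ',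
      show m - 1 - (k : ℤ) = m - ((k + 1 : ℕ) : ℤ) by push_cast; ring]
    congr 1
    rw [mul_comm]
    congr 1
    · refine Finset.prod_congr rfl fun r _ => ?_
      push_cast
      ring
    · simp

theorem ncoeff_derivative_iterate_neg_one {V : Type*} [AddCommGroup V] [Module ℂ V]
    (a : VertexOperator ℂ V) (k : ℕ) :
    ncoeff (derivative^[k] a) (-1) = (k.factorial : ℂ) • ncoeff a (-1 - k) := by
  rw [ncoeff_derivative_iterate, ← Finset.prod_range_add_one_eq_factorial]
  push_cast
  simp

theorem signedChoose_neg_one (l : ℕ) : signedChoose (-1) l = 1 := by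
  induction l with
  | zero => exact signedChoose_zero _
  | succ l ih =>
    have h := signedChoose_succ_mul (-1) l
    rw [ih] at h
    have h1 : (l : ℂ) + 1 ≠ 0 := by exact_mod_cast l.succ_ne_zero
    apply mul_right_cancel₀ h1
    rw [h]
    push_cast
    ring

theorem circTerm_neg_one {V : Type*} [AddCommGroup V] [Module ℂ V] (a b : VertexOperator ℂ V)
    (m : ℤ) (l : ℕ) (v : V) : circTerm (-1) a b m l v =
      ncoeff a (-1 - l) (ncoeff b (m + l) v) + ncoeff b (m - 1 - l) (ncoeff a l v) := by
  rw [circTerm_eq, signedChoose_neg_one, one_smul, show ((-1 : ℂ) ^ (-1 : ℤ)) = -1 by norm_num,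
    neg_one_smul, sub_neg_eq_add, ← sub_eq_add_neg]

theorem ncoeff_omega (c d : ℕ) (m : ℤ) (p : Fock n) : ncoeff (omega n c d) m p =
    ∑ i, ∑ᶠ l : ℕ, (ncoeff (derivative^[c] (alpha i)) (-1 - l)
        (ncoeff (derivative^[d] (alpha i)) (m + l) p) +
      ncoeff (derivative^[d] (alpha i)) (m - 1 - l) (ncoeff (derivative^[c] (alpha i)) l p)) := by
  simp only [omega, wick, map_sum, Finset.sum_apply, LinearMap.sum_apply, ncoeff_circ,
    circTerm_neg_one]

theorem derivative_alpha_mem (i : Fin n) (c : ℕ) : derivative^[c] (alpha i) ∈ algebra n :=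
  (algebra n).derivative_iterate_mem (alpha_mem i) c

theorem omega_mem (c d : ℕ) : omega n c d ∈ algebra n :=
  (algebra n).toSubmodule.sum_mem fun i _ =>
    (algebra n).circ_mem _ (derivative_alpha_mem i c) (derivative_alpha_mem i d)

theorem omega_state (c d : ℕ) : ncoeff (omega n c d) (-1) 1 =
    ((c.factorial : ℂ) * d.factorial) • (quad (Fin n) ℂ c d : Fock n) := by
  simp only [omega, wick, map_sum, Finset.sum_apply, LinearMap.sum_apply, quad, Finset.smul_sum]
  refine Finset.sum_congr rfl fun i _ => ?_
  rw [ncoeff_circ_vacuum _ (isCovariant_of_mem (derivative_alpha_mem i c))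
    (isCovariant_of_mem (derivative_alpha_mem i d)), ncoeff_derivative_iterate_neg_one,
    ncoeff_derivative_iterate_neg_one, ncoeff_alpha, LinearMap.smul_apply, LinearMap.smul_apply,
    map_smul, mode_neg, ncoeff_alpha, mode_neg, mul_one, smul_smul]

/-! ### The action of the orthogonal group -/

theorem subst_eq_linSubst (g : Matrix (Fin n) (Fin n) ℂ) (p : Fock n) :
    subst g p = linSubst g p := rfl

theorem isOrthInvariant_iff {p : Fock n} :
    IsOrthInvariant p ↔ ∀ g ∈ Matrix.orthogonalGroup (Fin n) ℂ, subst g p = p := by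
  refine forall_congr' fun g => ?_
  rw [subst_eq_linSubst, Matrix.mem_orthogonalGroup_iff]
  rfl

theorem transpose_mem_orthogonalGroup {g : Matrix (Fin n) (Fin n) ℂ}
    (hg : g ∈ Matrix.orthogonalGroup (Fin n) ℂ) :
    g.transpose ∈ Matrix.orthogonalGroup (Fin n) ℂ := by
  rw [Matrix.mem_orthogonalGroup_iff', Matrix.transpose_transpose]
  exact (Matrix.mem_orthogonalGroup_iff (Fin n) ℂ).1 hg

theorem ncoeff_act (g : Matrix (Fin n) (Fin n) ℂ) (a : VertexOperator ℂ (Fock n)) (m : ℤ)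
    (p : Fock n) : ncoeff (act g a) m p = subst g (ncoeff a m (subst g.transpose p)) := by
  rw [act, ncoeff_ofModes]
  rfl

theorem act_alpha {g : Matrix (Fin n) (Fin n) ℂ} (hg : g ∈ Matrix.orthogonalGroup (Fin n) ℂ)
    (i : Fin n) : act g (alpha i) = ∑ l, g l i • alpha l := by
  refine ext_modes fun m => LinearMap.ext fun p => ?_
  simp only [ncoeff_act, map_sum, map_smul, Finset.sum_apply, Pi.smul_apply, LinearMap.sum_apply,
    LinearMap.smul_apply, ncoeff_alpha]
  induction m using mode_cases with
  | h0 => simp [mode_zero]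
  | hpos k =>
    simp only [mode_pos, map_smul]
    rw [subst_eq_linSubst g.transpose, pderiv_linSubst, map_sum, Finset.smul_sum]
    refine Finset.sum_congr rfl fun l _ => ?_
    rw [map_mul, ← subst_eq_linSubst, subst_subst_transpose hg, subst_eq_linSubst, algHom_C,
      algebraMap_eq, C_mul', smul_comm, Matrix.transpose_apply]
  | hneg k =>
    simp only [mode_neg, map_mul]
    rw [subst_subst_transpose hg, subst_eq_linSubst, linSubst_X, Finset.sum_mul]
    simp only [C_mul', smul_mul_assoc]

theorem act_derivative_iterate (g : Matrix (Fin n) (Fin n) ℂ) (a : VertexOperator ℂ (Fock n))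
    (c : ℕ) : act g (derivative^[c] a) = derivative^[c] (act g a) := by
  refine ext_modes fun m => LinearMap.ext fun p => ?_
  simp only [ncoeff_act, ncoeff_derivative_iterate, LinearMap.smul_apply, map_smul]

theorem derivative_iterate_sum_smul (r : Fin n → ℂ) (c : ℕ) :
    derivative^[c] (∑ l, r l • alpha l : VertexOperator ℂ (Fock n)) =
      ∑ l, r l • derivative^[c] (alpha l) := by
  refine ext_modes fun m => LinearMap.ext fun p => ?_
  simp only [map_sum, map_smul, Finset.sum_apply, Pi.smul_apply, LinearMap.sum_apply,
    LinearMap.smul_apply, ncoeff_derivative_iterate, Finset.smul_sum]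
  exact Finset.sum_congr rfl fun l _ => smul_comm _ _ _

theorem act_omega {g : Matrix (Fin n) (Fin n) ℂ} (hg : g ∈ Matrix.orthogonalGroup (Fin n) ℂ)
    (c d : ℕ) : act g (omega n c d) = omega n c d := by
  have hsum : act g (omega n c d) = ∑ i, act g (wick (derivative^[c] (alpha i))
      (derivative^[d] (alpha i))) := by
    refine ext_modes fun m => LinearMap.ext fun p => ?_
    simp only [omega, ncoeff_act, map_sum, Finset.sum_apply, LinearMap.sum_apply]
  have h1 : ∀ l m, ∑ i, g l i * g m i = if l = m then 1 else 0 := fun l m => by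
    have := congrFun (congrFun (Matrix.mem_orthogonalGroup_iff (Fin n) ℂ |>.1 hg) l) m
    simpa [Matrix.mul_apply, Matrix.one_apply] using this
  rw [hsum]
  calc _ = ∑ i, ∑ l, ∑ m, (g l i * g m i) • circHom (-1) (derivative^[c] (alpha l))
        (derivative^[d] (alpha m)) := by
        refine Finset.sum_congr rfl fun i _ => ?_
        rw [wick, act_circ hg, act_derivative_iterate, act_derivative_iterate, act_alpha hg,
          derivative_iterate_sum_smul, derivative_iterate_sum_smul, ← circHom_apply]
        simp only [map_sum, LinearMap.sum_apply, map_smul, LinearMap.smul_apply, Finset.smul_sum,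
          smul_smul]
        rw [Finset.sum_comm]
        simp only [mul_comm]
    _ = ∑ l, ∑ m, (∑ i, g l i * g m i) • circHom (-1) (derivative^[c] (alpha l))
        (derivative^[d] (alpha m)) := by
        rw [Finset.sum_comm]
        refine Finset.sum_congr rfl fun l _ => ?_
        rw [Finset.sum_comm]
        simp only [Finset.sum_smul]
    _ = omega n c d := by
        simp [h1, omega, wick, circHom_apply]

theorem omega_mem_invariants (c d : ℕ) : omega n c d ∈ invariants n :=
  ⟨omega_mem c d, fun _ hg => act_omega hg c d⟩

/-- An invariant field has modes that commute with the group. -/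
theorem isOrthInvariant_ncoeff {a : VertexOperator ℂ (Fock n)} (ha : a ∈ invariants n) {p : Fock n}
    (hp : IsOrthInvariant p) (m : ℤ) : IsOrthInvariant (ncoeff a m p) := by
  rw [isOrthInvariant_iff] at hp ⊢
  intro g hg
  have h := ncoeff_act g a m p
  rw [ha.2 g hg, hp _ (transpose_mem_orthogonalGroup hg)] at h
  exact h.symm

/-! ### Modes on quadratic states -/

theorem pderiv_quad (i : Fin n) (b c d : ℕ) : pderiv (i, b) (quad (Fin n) ℂ c d) =
    (if b = c then X (i, d) else 0) + (if b = d then X (i, c) else 0 : Fock n) := by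
  classical
  simp only [quad, map_sum, Derivation.leibniz, pderiv_X, Pi.single_apply, smul_eq_mul, Prod.mk.injEq,
    mul_ite, mul_one, mul_zero, Finset.sum_add_distrib]
  rw [add_comm]
  congr 1 <;>
  · split_ifs with h
    · simp [h]
    · simp [Ne.symm h]

theorem mode_quad (i : Fin n) (l c d : ℕ) : mode i l (quad (Fin n) ℂ c d) =
    (if l = c + 1 then (l : ℂ) • X (i, d) else 0) +
      (if l = d + 1 then (l : ℂ) • X (i, c) else 0 : Fock n) := by
  rcases l with _ | b
  · simp [mode_zero]
  · rw [Nat.cast_succ, mode_pos, pderiv_quad]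
    simp only [add_left_inj, smul_add, smul_ite, smul_zero]
    push_cast
    rfl

theorem finite_support_ite {W : Type*} [AddCommGroup W] (c : ℕ) (u : W) :
    (Function.support fun l : ℕ => if l = c then u else 0).Finite :=
  (Set.finite_singleton c).subset fun l hl => by
    by_contra h
    exact hl (if_neg h)

theorem finite_support_ite_add_ite {W : Type*} [AddCommGroup W] (c d : ℕ) (u w : W) :
    Function.HasFiniteSupport fun l : ℕ => (if l = c then u else 0) + (if l = d then w else 0) :=
  ((finite_support_ite c u).union (finite_support_ite d w)).subset (Function.support_add _ _)

theorem finsum_ite_add_ite {W : Type*} [AddCommGroup W] (c d : ℕ) (u w : W) :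
    ∑ᶠ l : ℕ, ((if l = c then u else 0) + (if l = d then w else 0)) = u + w := by
  rw [finsum_add_distrib (finite_support_ite c u) (finite_support_ite d w),
    finsum_eq_single _ c fun l hl => if_neg hl, finsum_eq_single _ d fun l hl => if_neg hl,
    if_pos rfl, if_pos rfl]

theorem j_zero_apply (m : ℤ) (p : Fock n) : ncoeff (j n 0) m p =
    ∑ i, ∑ᶠ l : ℕ, (mode i (-1 - l) (mode i (m + l) p) + mode i (m - 1 - l) (mode i l p)) := by
  simp only [j, ncoeff_omega, Function.iterate_zero, id, ncoeff_alpha]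

theorem j_two_apply (m : ℤ) (p : Fock n) : ncoeff (j n 2) m p =
    ∑ i, ∑ᶠ l : ℕ, (((m + l : ℂ) * (m + l - 1)) • mode i (-1 - l) (mode i (m + l - 2) p) +
      ((m - 1 - l : ℂ) * (m - 2 - l)) • mode i (m - 1 - l - 2) (mode i l p)) := by
  simp only [j, ncoeff_omega, Function.iterate_zero, id, ncoeff_derivative_iterate, ncoeff_alpha,
    LinearMap.smul_apply, map_smul, Finset.prod_range_succ, Finset.prod_range_zero]
  refine Finset.sum_congr rfl fun i _ => finsum_congr fun l => ?_
  congr 2 <;>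
  · push_cast
    ring

/-- Only `αⁱ(1) αⁱ(1)`, the term `l = 1`, contributes, giving `2` for each `i`. This produces the
vacuum from `j⁰` alone. -/
theorem j_zero_three : ncoeff (j n 0) 3 (quad (Fin n) ℂ 0 0) = (2 * n : ℂ) • (1 : Fock n) := by
  rw [j_zero_apply]
  have h : ∀ i : Fin n, ∑ᶠ l : ℕ, (mode i (-1 - l) (mode i (3 + l) (quad (Fin n) ℂ 0 0)) +
      mode i (3 - 1 - l) (mode i l (quad (Fin n) ℂ 0 0))) = (2 : ℂ) • (1 : Fock n) := by
    intro i
    rw [finsum_eq_single _ 1]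
    · rw [show (3 + ((1 : ℕ) : ℤ)) = ((4 : ℕ) : ℤ) by norm_num, mode_quad, mode_quad]
      have := mode_pos i 0 (X (i, 0))
      simp only [Nat.cast_zero, zero_add, one_smul, pderiv_X_self] at this
      simp [this, ← two_smul ℂ]
    · intro l hl
      rw [show (3 + (l : ℤ)) = ((3 + l : ℕ) : ℤ) by push_cast; ring, mode_quad, mode_quad]
      simp [hl, show ¬ (3 + l = 1) by omega]
  simp only [h, Finset.sum_const, Finset.card_univ, Fintype.card_fin]
  module

theorem j_zero_zero_quad (c d : ℕ) : ncoeff (j n 0) 0 (quad (Fin n) ℂ c d) =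
    (2 : ℂ) • (((c : ℂ) + 1) • quad (Fin n) ℂ (c + 1) d + ((d : ℂ) + 1) • quad (Fin n) ℂ c (d + 1)) := by
  rw [j_zero_apply]
  simp only [quad_comm (R := ℂ) c (d + 1)]
  conv_rhs => simp only [quad, Finset.smul_sum, ← Finset.sum_add_distrib]
  refine Finset.sum_congr rfl fun i _ => ?_
  rw [← finsum_ite_add_ite (c + 1) (d + 1)
    ((2 : ℂ) • ((c : ℂ) + 1) • (X (i, c + 1) * X (i, d)) : Fock n)
    ((2 : ℂ) • ((d : ℂ) + 1) • (X (i, d + 1) * X (i, c))) |>.trans (smul_add _ _ _).symm]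
  refine finsum_congr fun l => ?_
  rw [zero_add, zero_sub, mode_quad, map_add, mode_neg, mode_neg]
  split_ifs with h1 h2 h2
  · subst h1
    simp only [mul_smul_comm]
    push_cast
    obtain rfl : c = d := by omega
    module
  · subst h1
    simp only [mul_smul_comm, mul_zero, add_zero]
    push_cast
    module
  · subst h2
    simp only [mul_smul_comm, mul_zero, zero_add]
    push_cast
    module
  · simp

/-- The two halves of the Wick product contribute `(c+1)(c+2)(c+3)` and `(c+1)²(c+2)`, which add up
to `2(c+1)(c+2)²`; likewise for `d`. -/
theorem j_two_one_quad (c d : ℕ) : ncoeff (j n 2) 1 (quad (Fin n) ℂ c d) =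
    (2 * ((c : ℂ) + 1) * (c + 2) ^ 2) • quad (Fin n) ℂ (c + 2) d +
      (2 * ((d : ℂ) + 1) * (d + 2) ^ 2) • quad (Fin n) ℂ c (d + 2) := by
  rw [j_two_apply]
  simp only [quad_comm (R := ℂ) c (d + 2)]
  conv_rhs => simp only [quad, Finset.smul_sum, ← Finset.sum_add_distrib]
  refine Finset.sum_congr rfl fun i _ => ?_
  let u (c d : ℕ) : Fock n := X (i, c + 2) * X (i, d)
  have h1 (l : ℕ) : (((1 : ℤ) + l : ℂ) * ((1 : ℤ) + l - 1)) • mode i (-1 - l)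
      (mode i (1 + l - 2) (quad (Fin n) ℂ c d)) =
      (if l = c + 2 then (((c : ℂ) + 3) * (c + 2) * (c + 1)) • u c d else 0) +
        (if l = d + 2 then (((d : ℂ) + 3) * (d + 2) * (d + 1)) • u d c else 0) := by
    rcases l with _ | l
    · simp
    rw [show (1 + ((l + 1 : ℕ) : ℤ) - 2) = l by push_cast; ring, mode_quad, map_add, smul_add]
    simp only [add_left_inj, show ∀ r, r + 2 = r + 1 + 1 from fun _ => rfl]
    congr 1
    · split_ifs with h
      · subst h
        rw [map_smul, mode_neg, smul_smul]
        congr 1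
        push_cast
        ring
      · rw [map_zero, smul_zero]
    · split_ifs with h
      · subst h
        rw [map_smul, mode_neg, smul_smul]
        congr 1
        push_cast
        ring
      · rw [map_zero, smul_zero]
  have h2 (l : ℕ) : (((1 : ℤ) - 1 - l : ℂ) * ((1 : ℤ) - 2 - l)) • mode i (1 - 1 - l - 2)
      (mode i l (quad (Fin n) ℂ c d)) =
      (if l = c + 1 then (((c : ℂ) + 1) * (c + 2) * (c + 1)) • u c d else 0) +
        (if l = d + 1 then (((d : ℂ) + 1) * (d + 2) * (d + 1)) • u d c else 0) := by
    rw [show (1 - 1 - (l : ℤ) - 2) = -1 - ((l + 1 : ℕ) : ℤ) by push_cast; ring, mode_quad, map_add,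
      smul_add]
    congr 1
    · split_ifs with h
      · subst h
        rw [map_smul, mode_neg, smul_smul]
        congr 1
        push_cast
        ring
      · rw [map_zero, smul_zero]
    · split_ifs with h
      · subst h
        rw [map_smul, mode_neg, smul_smul]
        congr 1
        push_cast
        ring
      · rw [map_zero, smul_zero]
  simp only [h1, h2]
  rw [finsum_add_distrib (finite_support_ite_add_ite _ _ _ _) (finite_support_ite_add_ite _ _ _ _),
    finsum_ite_add_ite, finsum_ite_add_ite]
  simp only [u]
  module

end Heisenberg

namespace Heisenberg

open VertexOperator QOA MvPolynomial

variable {n : ℕ}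

/-! ### The states of the words -/

/-- The linear combinations of words in `j⁰` and `j²`. -/
noncomputable def wordSpan (n : ℕ) : Submodule ℂ (VertexOperator ℂ (Fock n)) :=
  Submodule.span ℂ {w | IsWord {j n 0, j n 2} w}

/-- The states of the linear combinations of words in `j⁰` and `j²`. -/
noncomputable def wordStates (n : ℕ) : Submodule ℂ (Fock n) :=
  (wordSpan n).map (LinearMap.applyₗ (1 : Fock n) ∘ₗ LinearMap.proj (-1) ∘ₗ ncoeff)

theorem mem_wordStates {p : Fock n} :
    p ∈ wordStates n ↔ ∃ a ∈ wordSpan n, ncoeff a (-1) 1 = p := Iff.rfl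

theorem wordSpan_le : wordSpan n ≤ (invariants n).toSubmodule := by
  refine Submodule.span_le.2 fun w hw => ?_
  change IsWord _ w at hw
  induction hw with
  | letter h =>
    rcases h with rfl | rfl
    · exact omega_mem_invariants 0 0
    · exact omega_mem_invariants 0 2
  | circ k _ _ ha hb => exact (invariants n).circ_mem k ha hb

/-- If `p` is the state of `b`, then `a(m) p` is the state of `a ∘ₘ b`. -/
theorem ncoeff_mem_wordStates {a : VertexOperator ℂ (Fock n)} (ha : a ∈ wordSpan n) {p : Fock n}
    (hp : p ∈ wordStates n) (m : ℤ) : ncoeff a m p ∈ wordStates n := by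
  obtain ⟨b, hb, rfl⟩ := hp
  exact ⟨circ m a b, circ_mem_span_isWord m ha hb, ncoeff_circ_vacuum m
    (isCovariant_of_mem (wordSpan_le ha).1) (isCovariant_of_mem (wordSpan_le hb).1)⟩

theorem j_zero_mem : j n 0 ∈ wordSpan n := Submodule.subset_span (.letter (Or.inl rfl))

theorem j_two_mem : j n 2 ∈ wordSpan n := Submodule.subset_span (.letter (Or.inr rfl))

theorem quad_zero_mem : quad (Fin n) ℂ 0 0 ∈ wordStates n :=
  ⟨j n 0, j_zero_mem, (omega_state 0 0).trans (by simp)⟩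

theorem one_mem_wordStates (hn : 1 ≤ n) : (1 : Fock n) ∈ wordStates n := by
  have h := ncoeff_mem_wordStates (n := n) j_zero_mem quad_zero_mem 3
  rw [j_zero_three] at h
  refine (Submodule.smul_mem_iff _ ?_).1 h
  have : (n : ℂ) ≠ 0 := Nat.cast_ne_zero.2 (by omega)
  simpa using this

/-- The state `∑ᵢ αⁱ(-c-1) αⁱ(-d-1) 1` scaled by `c! d!`. -/
noncomputable def quadState (n c d : ℕ) : Fock n :=
  ((c.factorial : ℂ) * d.factorial) • quad (Fin n) ℂ c d

theorem quadState_comm (c d : ℕ) : quadState n c d = quadState n d c := by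
  rw [quadState, quadState, quad_comm, mul_comm]

theorem j_zero_zero_quadState (c d : ℕ) : ncoeff (j n 0) 0 (quadState n c d) =
    (2 : ℂ) • (quadState n (c + 1) d + quadState n c (d + 1)) := by
  rw [quadState, map_smul, j_zero_zero_quad, quadState, quadState, Nat.factorial_succ,
    Nat.factorial_succ]
  push_cast
  module

theorem j_two_one_quadState (c d : ℕ) : ncoeff (j n 2) 1 (quadState n c d) =
    (2 : ℂ) • (((c : ℂ) + 2) • quadState n (c + 2) d + ((d : ℂ) + 2) • quadState n c (d + 2)) := by
  rw [quadState, map_smul, j_two_one_quad, quadState, quadState, Nat.factorial_succ,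
    Nat.factorial_succ, Nat.factorial_succ, Nat.factorial_succ]
  push_cast
  module

/-- Translating the level `w` by `j⁰(0)` shows that neighbours on the level `w + 1` are opposite
modulo word states, so the level has at most one new direction. -/
theorem quadState_sub_mem {w : ℕ} (hw : ∀ c d, c + d = w → quadState n c d ∈ wordStates n) (c d : ℕ)
    (h : c + d = w + 1) :
    quadState n c d - (-1 : ℂ) ^ c • quadState n 0 (w + 1) ∈ wordStates n := by
  induction c generalizing d with
  | zero =>
    rw [zero_add] at h
    simp [h]
  | succ c ih =>
    have h1 := ncoeff_mem_wordStates j_zero_mem (hw c d (by omega)) 0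
    rw [j_zero_zero_quadState] at h1
    have h2 := (Submodule.smul_mem_iff _ two_ne_zero).1 h1
    have h3 := Submodule.sub_mem _ h2 (ih (d + 1) (by omega))
    convert h3 using 1
    rw [pow_succ]
    module

theorem quadState_mem_of_zero {w : ℕ} (hw : ∀ c d, c + d = w → quadState n c d ∈ wordStates n)
    (h0 : quadState n 0 (w + 1) ∈ wordStates n) (c d : ℕ) (h : c + d = w + 1) :
    quadState n c d ∈ wordStates n := by
  have := Submodule.add_mem _ (quadState_sub_mem hw c d h) (Submodule.smul_mem _ ((-1 : ℂ) ^ c) h0)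
  rwa [sub_add_cancel] at this

theorem quadState_even_mem (k : ℕ) :
    (∀ c d, c + d = 2 * k → quadState n c d ∈ wordStates n) ∧
      ∀ c d, c + d = 2 * k + 1 → quadState n c d ∈ wordStates n := by
  have hodd : ∀ k : ℕ, (∀ c d, c + d = 2 * k → quadState n c d ∈ wordStates n) →
      ∀ c d, c + d = 2 * k + 1 → quadState n c d ∈ wordStates n := by
    intro k hk
    refine quadState_mem_of_zero hk ?_
    -- On an odd level the symmetry in `c, d` makes the remaining direction equal to its own
    -- negative.
    have h := quadState_sub_mem hk (2 * k + 1) 0 rfl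
    rw [quadState_comm, (odd_two_mul_add_one k).neg_one_pow, neg_one_smul, sub_neg_eq_add,
      ← two_smul ℂ] at h
    exact (Submodule.smul_mem_iff _ two_ne_zero).1 h
  suffices H : ∀ c d, c + d = 2 * k → quadState n c d ∈ wordStates n from ⟨H, hodd k H⟩
  induction k with
  | zero =>
    intro c d h
    obtain ⟨rfl, rfl⟩ : c = 0 ∧ d = 0 := by omega
    exact Submodule.smul_mem _ _ quad_zero_mem
  | succ k ih =>
    refine quadState_mem_of_zero (hodd k ih) ?_
    have h1 := ncoeff_mem_wordStates j_two_mem (ih 0 (2 * k) (by omega)) 1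
    rw [j_two_one_quadState] at h1
    have h2 := (Submodule.smul_mem_iff _ two_ne_zero).1 h1
    -- Halving `j²(1)` on the state `(0, 2k)` gives `2` times `(2, 2k)` plus `2k + 2` times `(0, 2k
    -- + 2)`. Modulo word states these two agree, so the total coefficient is `2k + 4 ≠ 0`.
    have h3 := quadState_sub_mem (hodd k ih) 2 (2 * k) (by omega)
    have h4 := Submodule.sub_mem _ h2 (Submodule.smul_mem _ (2 : ℂ) h3)
    have h5 : ((2 * k : ℂ) + 4) ≠ 0 := by
      exact_mod_cast (show 2 * k + 4 ≠ 0 by omega)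
    refine (Submodule.smul_mem_iff _ h5).1 ?_
    convert h4 using 1
    simp only [zero_add, show 2 * k + 1 + 1 = 2 * k + 2 from rfl]
    push_cast
    module

theorem omega_mem_wordSpan (c d : ℕ) : omega n c d ∈ wordSpan n := by
  have h : quadState n c d ∈ wordStates n := by
    rcases Nat.even_or_odd' (c + d) with ⟨k, hk | hk⟩
    · exact (quadState_even_mem k).1 c d hk
    · exact (quadState_even_mem k).2 c d hk
  obtain ⟨a, ha, hs⟩ := mem_wordStates.1 h
  rwa [← eq_of_state_eq (wordSpan_le ha).1 (omega_mem c d) (hs.trans (omega_state c d).symm)]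

/-! ### Degrees -/

theorem totalDegree_pderiv_lt {σ R : Type*} [CommRing R] {p : MvPolynomial σ R} {x : σ}
    (h : pderiv x p ≠ 0) : (pderiv x p).totalDegree + 1 ≤ p.totalDegree := by
  have h1 : ∀ s ∈ (pderiv x p).support, (s.sum fun _ e => e) + 1 ≤ p.totalDegree := by
    intro s hs
    rw [mem_support_iff, coeff_pderiv] at hs
    have h2 := le_totalDegree (mem_support_iff.2 (left_ne_zero_of_mul hs))
    rwa [Finsupp.sum_add_index' (fun _ => rfl) (fun _ _ _ => rfl),
      Finsupp.sum_single_index rfl] at h2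
  obtain ⟨s, hs⟩ := support_nonempty.2 h
  have h2 := h1 s hs
  have h3 : (pderiv x p).totalDegree ≤ p.totalDegree - 1 :=
    Finset.sup_le fun s hs => Nat.le_sub_one_of_lt (h1 s hs)
  omega

/-- The inner mode has nonnegative index, so it lowers the degree or gives zero; the outer mode
raises it by at most one. -/
theorem mode_mode_mem_restrictTotalDegree (i : Fin n) {D : ℕ} {p : Fock n} (hp : p.totalDegree ≤ D)
    (m : ℤ) (l : ℕ) : mode i m (mode i l p) ∈ restrictTotalDegree (Fin n × ℕ) ℂ D := by
  rw [mem_restrictTotalDegree]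
  rcases l with _ | l
  · simp [mode_zero]
  rw [Nat.cast_succ, mode_pos]
  by_cases h : pderiv (i, l) p = 0
  · simp [h]
  have h1 := totalDegree_pderiv_lt h
  rw [map_smul]
  refine (totalDegree_smul_le _ _).trans ?_
  induction m using mode_cases with
  | h0 => simp [mode_zero]
  | hpos k =>
    rw [mode_pos]
    refine (totalDegree_smul_le _ _).trans ?_
    by_cases h' : pderiv (i, k) (pderiv (i, l) p) = 0
    · simp [h']
    · have := totalDegree_pderiv_lt h'
      omega
  | hneg k =>
    rw [mode_neg]
    refine (totalDegree_mul _ _).trans ?_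
    rw [totalDegree_X]
    omega

theorem prod_range_sub_eq_zero {c l : ℕ} (h : l < c) :
    ∏ r ∈ Finset.range c, ((r : ℂ) - (l : ℤ)) = 0 :=
  Finset.prod_eq_zero (Finset.mem_range.2 h) (by simp)

theorem ncoeff_derivative_alpha_mem (i : Fin n) {D : ℕ} {p : Fock n} (hp : p.totalDegree ≤ D)
    (c d : ℕ) (m : ℤ) (l : ℕ) : ncoeff (derivative^[c] (alpha i)) m
      (ncoeff (derivative^[d] (alpha i)) l p) ∈ restrictTotalDegree (Fin n × ℕ) ℂ D := by
  rw [ncoeff_derivative_iterate, ncoeff_derivative_iterate, LinearMap.smul_apply,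
    LinearMap.smul_apply, map_smul, ncoeff_alpha, ncoeff_alpha]
  refine Submodule.smul_mem _ _ ?_
  -- For `l < d` the derivative's coefficient vanishes; otherwise the shifted index `l - d` is still
  -- nonnegative.
  rcases lt_or_ge l d with h | h
  · rw [prod_range_sub_eq_zero h, zero_smul]
    exact Submodule.zero_mem _
  · refine Submodule.smul_mem _ _ ?_
    rw [← Nat.cast_sub h]
    exact mode_mode_mem_restrictTotalDegree i hp _ _

theorem finsum_sub_mem {M : Type*} [AddCommGroup M] [Module ℂ M] (U : Submodule ℂ M) {f : ℕ → M}
    (hf : (Function.support f).Finite) {u : M} (h0 : f 0 - u ∈ U) (h : ∀ l, f (l + 1) ∈ U) :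
    ∑ᶠ l, f l - u ∈ U := by
  obtain ⟨N, hN⟩ := hf.bddAbove
  rw [finsum_eq_sum_range (N := N + 1) fun l hl => by
    by_contra h
    have := hN h
    omega, Finset.sum_range_succ', add_sub_assoc]
  exact U.add_mem (U.sum_mem fun l _ => h l) h0

/-- Up to terms of lower degree, the mode `ω_{c,d}(-1)` is multiplication by a quadratic
invariant. -/
theorem omega_sub_mem (c d : ℕ) {D : ℕ} {p : Fock n} (hp : p.totalDegree ≤ D) :
    ncoeff (omega n c d) (-1) p - quadState n c d * p ∈ restrictTotalDegree (Fin n × ℕ) ℂ D := by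
  rw [ncoeff_omega, quadState, quad, Finset.smul_sum, Finset.sum_mul, ← Finset.sum_sub_distrib]
  -- Only the first product at `l = 0` consists of two creation operators; every other term has an
  -- inner mode of nonnegative index before the derivatives are expanded.
  refine Submodule.sum_mem _ fun i _ => finsum_sub_mem _ ?_ ?_ fun l => ?_
  · have h := finite_support_circTerm (-1) (derivative^[c] (alpha i)) (derivative^[d] (alpha i)) (-1) p
    simpa only [circTerm_neg_one] using h
  · have h1 : ncoeff (derivative^[c] (alpha i)) (-1 - (0 : ℕ))
        (ncoeff (derivative^[d] (alpha i)) (-1 + (0 : ℕ)) p) =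
        (((c.factorial : ℂ) * d.factorial) • (X (i, c) * X (i, d))) * p := by
      rw [Nat.cast_zero, sub_zero, add_zero, ncoeff_derivative_iterate_neg_one,
        ncoeff_derivative_iterate_neg_one, ncoeff_alpha, LinearMap.smul_apply, LinearMap.smul_apply,
        map_smul, mode_neg, ncoeff_alpha, mode_neg, smul_smul, smul_mul_assoc, mul_assoc]
    rw [h1, add_sub_cancel_left]
    exact ncoeff_derivative_alpha_mem i hp _ _ _ _
  · refine Submodule.add_mem _ ?_ (ncoeff_derivative_alpha_mem i hp _ _ _ _)
    rw [show (-1 + ((l + 1 : ℕ) : ℤ)) = (l : ℕ) by push_cast; ring]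
    exact ncoeff_derivative_alpha_mem i hp _ _ _ _

/-! ### Invariant states by induction on the degree. -/

theorem IsOrthInvariant.homogeneousComponent {p : Fock n} (hp : IsOrthInvariant p) (e : ℕ) :
    IsOrthInvariant (homogeneousComponent e p) := by
  intro g hg
  have h : ∀ q : Fock n, linSubst g (MvPolynomial.homogeneousComponent e q) =
      MvPolynomial.homogeneousComponent e (linSubst g q) := by
    intro q
    conv_rhs => rw [← sum_homogeneousComponent q]
    rw [map_sum, map_sum]
    simp only [homogeneousComponent_of_mem
      (isHomogeneous_linSubst g (homogeneousComponent_isHomogeneous _ q))]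
    rw [Finset.sum_ite_eq]
    split_ifs with h
    · rfl
    · rw [homogeneousComponent_eq_zero _ _ (by simpa using h), map_zero]
  rw [h, hp g hg]

theorem mem_wordStates_of_isOrthInvariant (hn : 1 ≤ n) (D : ℕ) {p : Fock n} (hp : IsOrthInvariant p)
    (hD : p.totalDegree ≤ D) : p ∈ wordStates n := by
  induction D using Nat.strong_induction_on generalizing p with
  | _ D ih =>
  rw [← sum_homogeneousComponent p]
  refine Submodule.sum_mem _ fun e he => ?_
  have heD : e ≤ D := by
    have := Finset.mem_range.1 he
    omega
  have h := (Heisenberg.IsOrthInvariant.homogeneousComponent hp e).mem_span_complex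
    (homogeneousComponent_isHomogeneous e p)
  refine Submodule.span_le.2 ?_ h
  rintro q (hq : IsQuadMonomial e q)
  cases hq with
  | one => exact one_mem_wordStates hn
  | @mul c d e q hq =>
    have hqi := hq.isOrthInvariant
    have hqd : q.totalDegree ≤ e := hq.isHomogeneous.totalDegree_le
    have h1 := ncoeff_mem_wordStates (omega_mem_wordSpan c d) (ih e (by omega) hqi hqd) (-1)
    -- The correction term is itself invariant and two degrees lower, so the induction hypothesis
    -- applies to it as well as to `q`.
    have hri : IsOrthInvariant (ncoeff (omega n c d) (-1) q - quadState n c d * q) :=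
      (orthInvariants (Fin n) ℕ ℂ).sub_mem
        (isOrthInvariant_ncoeff (omega_mem_invariants c d) hqi (-1))
        (IsOrthInvariant.mul ((orthInvariants (Fin n) ℕ ℂ).smul_mem _ (isOrthInvariant_quad c d)) hqi)
    have h2 := ih e (by omega) hri ((mem_restrictTotalDegree _ _ _).1 (omega_sub_mem c d hqd))
    have h3 := Submodule.sub_mem _ h1 h2
    rw [sub_sub_cancel, quadState, smul_mul_assoc] at h3
    refine (Submodule.smul_mem_iff _ ?_).1 h3
    exact mul_ne_zero (Nat.cast_ne_zero.2 c.factorial_ne_zero)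
      (Nat.cast_ne_zero.2 d.factorial_ne_zero)

end Heisenberg

theorem mainTheorem6 (n : ℕ) (hn : 1 ≤ n) :
    QOA.Generates {Heisenberg.j n 0, Heisenberg.j n 2} (Heisenberg.invariants n) := by
  refine ⟨?_, fun a ha => ?_⟩
  · rintro _ (rfl | rfl)
    · exact Heisenberg.omega_mem_invariants 0 0
    · exact Heisenberg.omega_mem_invariants 0 2
  -- The vacuum is invariant, hence so is the state of `a`; a combination of words with the same
  -- state must equal `a`.
  · obtain ⟨b, hb, hs⟩ := Heisenberg.mem_wordStates.1
      (Heisenberg.mem_wordStates_of_isOrthInvariant hn _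
        (Heisenberg.isOrthInvariant_ncoeff ha (p := 1) (fun _ _ => map_one _) (-1)) le_rfl)
    rw [Heisenberg.eq_of_state_eq ha.1 (Heisenberg.wordSpan_le hb).1 hs.symm]
    exact hb
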